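/- Let $\mathcal S,\mathcal A$ be finite sets and consider a Markov decision process with transition matrices $\{P_a\}_{a\in\mathcal A}$, reward $\mathcal R:\mathcal S\times\mathcal A\to[0,1]$ and discount factor $\gamma\in(0,1)$. Let $\pi$ (target) and $\pi_b$ (behavior) be policies with $\pi_b(a|s)>0$ for all $(s,a)$, such that the Markov chain $\{S_k\}$ induced by $\pi_b$, with transition matrix $P_{\pi_b}(s,s')=\sum_a\pi_b(a|s)P_a(s,s')$, is irreducible and aperiodic. Let $n\ge1$ be an integer, $\bar\rho=1/\min_{s,a}\pi_b(a|s)$, $1\le\bar c\le\bar\rho$, and put $c(s,a)=\min(\bar c,\pi(a|s)/\pi_b(a|s))$, $\rho(s,a)=\min(\bar\rho,\pi(a|s)/\pi_b(a|s))$. Along a trajectory $\{(S_k,A_k)\}$ generated by $\pi_b$ (with any initial distribution), the V-trace algorithm with constant stepsize $\alpha$ and initialization $V_0\in\mathbb R^{\mathcal S}$ is $$V_{k+1}(s)=V_k(s)+\alpha\sum_{i=k}^{k+n-1}\gamma^{i-k}\Big(\prod_{j=k}^{i-1}c(S_j,A_j)\Big)\rho(S_i,A_i)\big(\mathcal R(S_i,A_i)+\gamma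 V_k(S_{i+1})-V_k(S_i)\big)$$ if $s=S_k$, and $V_{k+1}(s)=V_k(s)$ otherwise. Let $V_\pi(s)=\mathbb E_\pi[\sum_{k\ge0}\gamma^k\mathcal R(S_k,A_k)\mid S_0=s]$, $C_{\min}=\min_s\sum_a\min(\bar c\,\pi_b(a|s),\pi(a|s))$, and $\eta=\sum_{i=0}^{n-1}(\gamma\bar c)^i$, i.e. $\eta=\frac{1-(\gamma\bar c)^n}{1-\gamma\bar c}$ if $\gamma\bar c\ne1$ and $\eta=n$ if $\gamma\bar c=1$. Then $\{S_k\}$ has a unique stationary distribution $\kappa_b$; let $\mathcal K_{\min}=\min_s\kappa_b(s)$. Its mixing times $t_\delta=\min\{k\ge0:\max_s\|P_{\pi_b}^k(s,\cdot)-\kappa_b\|_{\mathrm{TV}}\le\delta\}$ satisfy, for some constant $L$, $$t_\delta\le L(\log(1/\delta)+1)\quad\text{for all }\delta\in(0,1].\tag{1}$$ Moreover, there are a numerical constant $C>0$ and a numerical exponent $p\in\mathbb N$ (independent of the decision process, the policies, $n$, $\bar c$, $L$, $V_0$ and $\epsilon$) such that, for every $L$ satisfying (1), every $V_0$ and every $\epsilon\in(0,1/2]$,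 there are a stepsize $\alpha\in(0,1)$ and a number $N$ of iterations such that $\mathbb E[\|V_k-V_\pi\|_\infty]\le\epsilon$ for all $k\ge N$, whatever the initial distribution of the trajectory, and the number $N+n$ of samples that determine $V_N$ satisfies $$N+n\le C(1+L)\cdot\frac{\log^2(1/\epsilon)}{\epsilon^2}\cdot\frac1{(1-\gamma)^5}\cdot\frac{n\bar\rho^2\eta^2(1-\gamma C_{\min})^3}{(1-(\gamma C_{\min})^n)^3}\cdot\frac1{\mathcal K_{\min}^3}\cdot\Lambda^p,$$ where $\Lambda=1+\log\frac1{1-\gamma}+\log n+\log\bar\rho+\log\eta+\log\frac1{\mathcal K_{\min}}+\log(1+L)+\log(1+\|V_0\|_\infty)$. -/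

import Mathlib

open MeasureTheory

noncomputable section

namespace VTrace

/-- A discounted Markov decision process with finite state set `S` and finite action set `A`:
transition matrices `P a`, rewards in `[0, 1]` and a discount factor in `(0, 1)`. -/
structure MDP (S A : Type*) [Fintype S] [Fintype A] where
  P : A → Matrix S S ℝ
  P_nonneg : ∀ a s s', 0 ≤ P a s s'
  P_sum : ∀ a s, ∑ s', P a s s' = 1
  reward : S → A → ℝ
  reward_nonneg : ∀ s a, 0 ≤ reward s a
  reward_le_one : ∀ s a, reward s a ≤ 1
  γ : ℝ
  γ_pos : 0 < γ
  γ_lt_one : γ < 1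

/-- A stationary randomized policy; `prob s a` is `π(a|s)`. -/
structure Policy (S A : Type*) [Fintype S] [Fintype A] where
  prob : S → A → ℝ
  nonneg : ∀ s a, 0 ≤ prob s a
  sum_eq_one : ∀ s, ∑ a, prob s a = 1

section MarkovChains

variable {S : Type*} [Fintype S] [DecidableEq S]

/-- Every state of the chain with transition matrix `P` has period `1`: the only common divisor of
its possible return times is `1`. -/
def IsAperiodic (P : Matrix S S ℝ) : Prop :=
  ∀ s, ∀ d : ℕ, (∀ k : ℕ, 0 < k → 0 < (P ^ k) s s → d ∣ k) → d = 1

/-- `κ` is a stationary (probability) distribution of the transition matrix `P`. -/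
def IsStationaryDist (P : Matrix S S ℝ) (κ : S → ℝ) : Prop :=
  κ ∈ stdSimplex ℝ S ∧ Matrix.vecMul κ P = κ

/-- Total variation distance of two distributions on a finite set. -/
def tvDist (μ ν : S → ℝ) : ℝ := (1 / 2) * ∑ s, |μ s - ν s|

/-- The mixing time with precision `δ`: the least `k` such that `P ^ k (s, ·)` is within total
variation distance `δ` of `κ` for every initial state `s`. -/
def mixingTime (P : Matrix S S ℝ) (κ : S → ℝ) (δ : ℝ) : ℕ :=
  sInf {k : ℕ | ∀ s, tvDist ((P ^ k) s) κ ≤ δ}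

/-- `L` is a constant in the geometric mixing bound `t_δ ≤ L (log (1/δ) + 1)`. -/
def IsMixingConst (P : Matrix S S ℝ) (κ : S → ℝ) (L : ℝ) : Prop :=
  ∀ δ : ℝ, 0 < δ → δ ≤ 1 → (mixingTime P κ δ : ℝ) ≤ L * (Real.log (1 / δ) + 1)

end MarkovChains

section Trajectories

variable {S A : Type*} [Fintype S] [Fintype A]

/-- Transition matrix of the state chain under the policy `π`. -/
def MDP.trans (M : MDP S A) (π : Policy S A) : Matrix S S ℝ :=
  fun s s' => ∑ a, π.prob s a * M.P a s s'

/-- Expected one-step reward under the policy `π`. -/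
def MDP.meanReward (M : MDP S A) (π : Policy S A) : S → ℝ :=
  fun s => ∑ a, π.prob s a * M.reward s a

/-- The value function `V_π(s) = E_π[∑ₖ γᵏ R(Sₖ, Aₖ) | S₀ = s]`, where
`E_π[R(Sₖ, Aₖ) | S₀ = s]` is expanded as `∑ₓ P_π ^ k (s, x) R_π(x)`. The theorem
`IsTrajectory.integral_discounted` below shows that this is indeed the expectation of the
discounted return over a trajectory generated by `π` from `s`. -/
def MDP.value [DecidableEq S] (M : MDP S A) (π : Policy S A) : S → ℝ :=
  fun s => ∑' k : ℕ, M.γ ^ k * ∑ x, (M.trans π ^ k) s x * M.meanReward π x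

/-- The random sequence `(X₀, Y₀), (X₁, Y₁), …` of states and actions is a trajectory of the
decision process `M` under the policy `π` (with an arbitrary law of the initial state): the first
action has conditional law `π(·|X₀)`, and, given the history up to time `k`, the next state has law
`P_{Y_k}(X_k, ·)` and the next action has law `π(·|X_{k+1})`. -/
structure IsTrajectory {Ω : Type*} [MeasurableSpace Ω] (μ : Measure Ω)
    (M : MDP S A) (π : Policy S A) (X : ℕ → Ω → S) (Y : ℕ → Ω → A) : Prop where
  measurableSet_state : ∀ k s, MeasurableSet {ω | X k ω = s}
  measurableSet_action : ∀ k a, MeasurableSet {ω | Y k ω = a}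
  init : ∀ s a, μ.real {ω | X 0 ω = s ∧ Y 0 ω = a} = μ.real {ω | X 0 ω = s} * π.prob s a
  step : ∀ (k : ℕ) (h : Fin (k + 1) → S × A) (s : S) (a : A),
    μ.real {ω | (∀ i : Fin (k + 1), X i ω = (h i).1 ∧ Y i ω = (h i).2) ∧
        X (k + 1) ω = s ∧ Y (k + 1) ω = a} =
      μ.real {ω | ∀ i : Fin (k + 1), X i ω = (h i).1 ∧ Y i ω = (h i).2} *
        (M.P (h (Fin.last k)).2 (h (Fin.last k)).1 s * π.prob s a)

end Trajectories

section Algorithm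

variable {S A : Type*} [Fintype S] [Fintype A]

/-- The importance sampling ratio at `(s, a)`, truncated at level `c`. -/
def truncRatio (πb π : Policy S A) (c : ℝ) (s : S) (a : A) : ℝ :=
  min c (π.prob s a / πb.prob s a)

/-- The temporal difference `R(s, a) + γ V(s') - V(s)`. -/
def MDP.tempDiff (M : MDP S A) (V : S → ℝ) (s : S) (a : A) (s' : S) : ℝ :=
  M.reward s a + M.γ * V s' - V s

/-- The iterates of the asynchronous `n`-step V-trace algorithm with behavior policy `πb`, target
policy `π`, truncation levels `cbar`, `ρbar`, step sizes `α k` and initialization `V₀`, along the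
sequence of states `x` and actions `y`. Only the entry of the current state `x k` is updated. -/
def iterate [DecidableEq S] (M : MDP S A) (πb π : Policy S A) (n : ℕ) (cbar ρbar : ℝ) (α : ℕ → ℝ)
    (V₀ : S → ℝ) (x : ℕ → S) (y : ℕ → A) : ℕ → S → ℝ
  | 0 => V₀
  | k + 1 => fun s =>
      let V := iterate M πb π n cbar ρbar α V₀ x y k
      if s = x k then
        V s + α k * ∑ i ∈ Finset.range n, M.γ ^ i *
          (∏ j ∈ Finset.range i, truncRatio πb π cbar (x (k + j)) (y (k + j))) *
          truncRatio πb π ρbar (x (k + i)) (y (k + i)) *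
          M.tempDiff V (x (k + i)) (y (k + i)) (x (k + i + 1))
      else V s

/-- `C_min = min_s ∑_a min (cbar π_b(a|s), π(a|s))`. -/
def Cmin (πb π : Policy S A) (cbar : ℝ) : ℝ :=
  ⨅ s, ∑ a, min (cbar * πb.prob s a) (π.prob s a)

/-- `η(γ, cbar) = (1 - (γ cbar)ⁿ) / (1 - γ cbar)`, to be read as `n` when `γ cbar = 1`. -/
def eta (n : ℕ) (γ cbar : ℝ) : ℝ :=
  if γ * cbar = 1 then n else (1 - (γ * cbar) ^ n) / (1 - γ * cbar)

end Algorithm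

/-! The value function is the expected discounted return of a trajectory. -/

section Expectation

variable {S A : Type*} [Fintype S] [Fintype A] {Ω : Type*} [MeasurableSpace Ω] {μ : Measure Ω}
  {M : MDP S A} {π : Policy S A} {X : ℕ → Ω → S} {Y : ℕ → Ω → A}

theorem sum_real_inter [IsFiniteMeasure μ] {T : Type*} [Fintype T] (f : Ω → T)
    (hf : ∀ t, MeasurableSet {ω | f ω = t}) (E : Set Ω) (hE : MeasurableSet E) :
    ∑ t, μ.real {ω | f ω = t ∧ ω ∈ E} = μ.real E := by
  rw [← measureReal_iUnion_fintype]
  · congr 1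
    ext ω
    simp
  · intro i j hij
    refine Set.disjoint_left.2 fun ω h1 h2 => hij ?_
    exact h1.1.symm.trans h2.1
  · intro t
    exact (hf t).inter hE

theorem IsTrajectory.real_step [IsFiniteMeasure μ] (h : IsTrajectory μ M π X Y) (k : ℕ)
    (s : S) (a : A) (s' : S) (a' : A) :
    μ.real {ω | (X k ω = s ∧ Y k ω = a) ∧ X (k + 1) ω = s' ∧ Y (k + 1) ω = a'} =
      μ.real {ω | X k ω = s ∧ Y k ω = a} * (M.P a s s' * π.prob s' a') := by
  classical
  have hm : ∀ k s a, MeasurableSet {ω | X k ω = s ∧ Y k ω = a} := fun k s a =>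
    (h.measurableSet_state k s).inter (h.measurableSet_action k a)
  let f : Ω → (Fin (k + 1) → S × A) := fun ω i => (X i ω, Y i ω)
  have hfs : ∀ t, {ω | f ω = t} =
      {ω | ∀ i : Fin (k + 1), X i ω = (t i).1 ∧ Y i ω = (t i).2} := by
    intro t
    ext ω
    simp [f, funext_iff, Prod.ext_iff]
  have hf : ∀ t, MeasurableSet {ω | f ω = t} := by
    intro t
    rw [hfs, Set.ofPred_forall]
    exact MeasurableSet.iInter fun i => hm _ _ _
  refine (sum_real_inter f hf _ ((hm k s a).inter (hm (k + 1) s' a'))).symm.trans ?_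
  rw [← sum_real_inter f hf _ (hm k s a), Finset.sum_mul]
  refine Finset.sum_congr rfl fun t _ => ?_
  by_cases ht : t (Fin.last k) = (s, a)
  · have h1 : {ω | f ω = t ∧ ω ∈ {ω | X k ω = s ∧ Y k ω = a} ∩
        {ω | X (k + 1) ω = s' ∧ Y (k + 1) ω = a'}} =
        {ω | (∀ i : Fin (k + 1), X i ω = (t i).1 ∧ Y i ω = (t i).2) ∧
          X (k + 1) ω = s' ∧ Y (k + 1) ω = a'} := by
      ext ω
      have := Set.ext_iff.1 (hfs t) ω
      simp only [Set.mem_ofPred_eq, Set.mem_inter_iff] at this ⊢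
      rw [this]
      constructor
      · rintro ⟨h1, -, h2⟩
        exact ⟨h1, h2⟩
      · rintro ⟨h1, h2⟩
        refine ⟨h1, ?_, h2⟩
        have := h1 (Fin.last k)
        simpa [ht] using this
    have h2 : {ω | f ω = t ∧ ω ∈ {ω | X k ω = s ∧ Y k ω = a}} =
        {ω | ∀ i : Fin (k + 1), X i ω = (t i).1 ∧ Y i ω = (t i).2} := by
      ext ω
      have := Set.ext_iff.1 (hfs t) ω
      simp only [Set.mem_ofPred_eq] at this ⊢
      rw [this]
      refine ⟨fun h1 => h1.1, fun h1 => ⟨h1, ?_⟩⟩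
      have := h1 (Fin.last k)
      simpa [ht] using this
    have h3 := h.step k t s' a'
    rw [ht] at h3
    exact (congrArg μ.real h1).trans (h3.trans (by rw [← h2]))
  · have hno : ∀ ω, f ω = t → ¬ (X k ω = s ∧ Y k ω = a) := by
      rintro ω rfl ⟨h1, h2⟩
      exact ht (by simp [f, h1, h2])
    have h1 : {ω | f ω = t ∧ ω ∈ {ω | X k ω = s ∧ Y k ω = a} ∩
        {ω | X (k + 1) ω = s' ∧ Y (k + 1) ω = a'}} = ∅ := by
      ext ω
      simp only [Set.mem_ofPred_eq, Set.mem_inter_iff, Set.mem_empty_iff_false, iff_false]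
      exact fun h => hno ω h.1 h.2.1
    have h2 : {ω | f ω = t ∧ ω ∈ {ω | X k ω = s ∧ Y k ω = a}} = ∅ := by
      ext ω
      simp only [Set.mem_ofPred_eq, Set.mem_empty_iff_false, iff_false]
      exact fun h => hno ω h.1 h.2
    have e1 := congrArg μ.real h1
    have e2 := congrArg μ.real h2
    rw [measureReal_empty] at e1 e2
    refine e1.trans ?_
    rw [e2, zero_mul]

/-- The law of the state-action pair at time `k` of a trajectory that starts at `s`. -/
theorem IsTrajectory.real_pair [DecidableEq S] [IsFiniteMeasure μ] (h : IsTrajectory μ M π X Y)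
    {s : S} (hs : ∀ x, μ.real {ω | X 0 ω = x} = if x = s then 1 else 0) (k : ℕ) (x : S) (a : A) :
    μ.real {ω | X k ω = x ∧ Y k ω = a} = (M.trans π ^ k) s x * π.prob x a := by
  induction k generalizing x a with
  | zero =>
    rw [h.init, hs, pow_zero, Matrix.one_apply]
    simp only [eq_comm]
  | succ k ih =>
    have hm : ∀ k s a, MeasurableSet {ω | X k ω = s ∧ Y k ω = a} := fun k s a =>
      (h.measurableSet_state k s).inter (h.measurableSet_action k a)
    have hf : ∀ t : S × A, MeasurableSet {ω | (X k ω, Y k ω) = t} := by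
      intro t
      simpa [Prod.ext_iff] using hm k t.1 t.2
    rw [← sum_real_inter (fun ω => (X k ω, Y k ω)) hf _ (hm (k + 1) x a), Fintype.sum_prod_type]
    have key : ∀ (z : S) (b : A), μ.real {ω | (X k ω, Y k ω) = (z, b) ∧
        ω ∈ {ω | X (k + 1) ω = x ∧ Y (k + 1) ω = a}} =
        (M.trans π ^ k) s z * (π.prob z b * M.P b z x) * π.prob x a := by
      intro z b
      have := h.real_step k z b x a
      simp only [Prod.mk.injEq, Set.mem_ofPred_eq]
      rw [this, ih]
      ring
    simp only [key]
    rw [pow_succ, Matrix.mul_apply, Finset.sum_mul]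
    refine Finset.sum_congr rfl fun z _ => ?_
    rw [MDP.trans, Finset.mul_sum, Finset.sum_mul]

/-- For a trajectory under `π` with `X₀ = s`, the expected discounted return is `V_π(s)`. -/
theorem IsTrajectory.integral_discounted [DecidableEq S] [IsProbabilityMeasure μ]
    (h : IsTrajectory μ M π X Y) (s : S) (hs : ∀ᵐ ω ∂μ, X 0 ω = s) :
    ∫ ω, ∑' k : ℕ, M.γ ^ k * M.reward (X k ω) (Y k ω) ∂μ = M.value π s := by
  classical
  have hs' : ∀ x, μ.real {ω | X 0 ω = x} = if x = s then 1 else 0 := by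
    intro x
    split_ifs with hx
    · subst hx
      rw [Measure.real, (prob_compl_eq_zero_iff (h.measurableSet_state 0 x)).1 hs]
      simp
    · rw [Measure.real, measure_mono_null _ hs]
      · simp
      · intro ω hω
        simp only [Set.mem_ofPred_eq] at hω
        simp [hω, hx]
  have hm : ∀ k s a, MeasurableSet {ω | X k ω = s ∧ Y k ω = a} := fun k s a =>
    (h.measurableSet_state k s).inter (h.measurableSet_action k a)
  have hrep : ∀ k, (fun ω => M.γ ^ k * M.reward (X k ω) (Y k ω)) = fun ω =>
      ∑ p : S × A, Set.indicator {ω | X k ω = p.1 ∧ Y k ω = p.2}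
        (fun _ => M.γ ^ k * M.reward p.1 p.2) ω := by
    intro k
    funext ω
    rw [Finset.sum_eq_single (X k ω, Y k ω)]
    · simp
    · rintro ⟨a, b⟩ - hne
      refine Set.indicator_of_notMem ?_ _
      rintro ⟨h1, h2⟩
      exact hne (by simp only at h1 h2; rw [h1, h2])
    · simp
  have hint : ∀ k, Integrable (fun ω => M.γ ^ k * M.reward (X k ω) (Y k ω)) μ := by
    intro k
    rw [hrep]
    exact integrable_finsetSum _ fun p _ => (integrable_const _).indicator (hm _ _ _)
  have hval : ∀ k, ∫ ω, M.γ ^ k * M.reward (X k ω) (Y k ω) ∂μ =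
      M.γ ^ k * ∑ x, (M.trans π ^ k) s x * M.meanReward π x := by
    intro k
    rw [hrep, integral_finsetSum _ fun p _ => (integrable_const _).indicator (hm _ _ _)]
    simp only [integral_indicator_const _ (hm _ _ _), h.real_pair hs', smul_eq_mul]
    rw [Fintype.sum_prod_type, Finset.mul_sum]
    refine Finset.sum_congr rfl fun x _ => ?_
    rw [MDP.meanReward, Finset.mul_sum, Finset.mul_sum]
    refine Finset.sum_congr rfl fun a _ => ?_
    ring
  have hnn : ∀ k ω, 0 ≤ M.γ ^ k * M.reward (X k ω) (Y k ω) := fun k ω =>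
    mul_nonneg (pow_nonneg M.γ_pos.le _) (M.reward_nonneg _ _)
  have hle : ∀ k, ∫ ω, ‖M.γ ^ k * M.reward (X k ω) (Y k ω)‖ ∂μ ≤ M.γ ^ k := by
    intro k
    refine (integral_mono (hint k).norm (integrable_const (M.γ ^ k)) fun ω => ?_).trans (by simp)
    simp only [Real.norm_of_nonneg (hnn k ω)]
    exact mul_le_of_le_one_right (pow_nonneg M.γ_pos.le _) (M.reward_le_one _ _)
  have hsum := hasSum_integral_of_summable_integral_norm hint
    (Summable.of_nonneg_of_le (fun k => integral_nonneg fun ω => norm_nonneg _) hle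
      (summable_geometric_of_lt_one M.γ_pos.le M.γ_lt_one))
  rw [← hsum.tsum_eq, MDP.value]
  exact tsum_congr hval

end Expectation

end VTrace

end

namespace VTrace

/-! ### Finite Markov chains: stationary law and geometric mixing. -/

section FiniteChains

variable {S : Type*} [Fintype S] [DecidableEq S] {P : Matrix S S ℝ}

/-! The error x_k = V_k − V_π follows x_{k+1} = x_k + α U_k(x_k) with U_k affine and random. Because
ρbar = 1 / min π_b, the ratios ρ are never truncated, so the mean correction vanishes at V_π
whatever cbar is (`MDP.sum_prob_mul_condMean`). Averaged over the stationary law κ, the update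
becomes a linear map Ā (`MDP.drift`), and 1 + αĀ contracts the sup norm by 1 − αw, where w = K_min
(1 − γ) ∑_{i<n} (γ C_min)^i (`MDP.norm_add_smul_drift_le`).

The sup norm is not smooth, so its square has no second order expansion to serve as a Lyapunov
function. Instead E[ℓ(x_k)²] ≤ ‖ℓ‖² a_k is propagated for all linear functionals ℓ at once, with ‖ℓ‖
the dual norm. A mean step replaces ℓ by ℓ ∘ (1 + αĀ), whose norm is at most (1 − αw)‖ℓ‖; the noise
adds ‖ℓ‖² α² G (E‖x_k‖² + b²). Coordinates are functionals of norm at most 1, so E‖x_k‖² ≤ |S| a_k,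
and the recursion closes once αG|S| ≤ w/2 (`integral_sq_norm_le`). The factor |S| is paid for by |S|
K_min ≤ 1 and w ≤ K_min.

The noise is Markovian, and iterates look n steps ahead. The cross term is therefore compared with
the iterate t = n + τ steps earlier, τ being the mixing time at precision α: that iterate is fixed
early enough for the current state to be almost stationary given it
(`IsTrajectory.abs_integral_mul_update_sub_le`), and the iterate moves only by a relative O(αgt)
within the window, where g = 3 ρbar η (`norm_sub_le_of_increments`, `sq_apply_step_le`).

With G of order g²t and b = 1/(1 − γ), the limiting error |S| α G b² / w is of order ε² when αt is
of order ε² w² / (ρbar² η² b²). Running for log / (αw) steps then costs b²/w³, which is the origin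
of (1 − γ)^{-5} and K_min^{-3}. `exists_stepsize` resolves the circular dependence of τ on α.
Existence of κ and of L comes from the ℓ¹ contraction of a positive power of the transition matrix.
-/

theorem pow_entry_nonneg (hP : ∀ s s', 0 ≤ P s s') (k : ℕ) (s s' : S) : 0 ≤ (P ^ k) s s' := by
  induction k generalizing s s' with
  | zero => rw [pow_zero, Matrix.one_apply]; split_ifs <;> norm_num
  | succ k ih =>
    rw [pow_succ, Matrix.mul_apply]
    exact Finset.sum_nonneg fun x _ => mul_nonneg (ih s x) (hP x s')

theorem pow_row_sum (hrow : ∀ s, ∑ s', P s s' = 1) (k : ℕ) (s : S) :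
    ∑ s', (P ^ k) s s' = 1 := by
  induction k generalizing s with
  | zero => simp [Matrix.one_apply]
  | succ k ih =>
    simp only [pow_succ, Matrix.mul_apply]
    rw [Finset.sum_comm]
    simp only [← Finset.mul_sum, hrow, mul_one, ih]

theorem pow_add_entry_pos (hP : ∀ s s', 0 ≤ P s s') {j k : ℕ} {s x s' : S}
    (h1 : 0 < (P ^ j) s x) (h2 : 0 < (P ^ k) x s') : 0 < (P ^ (j + k)) s s' := by
  rw [pow_add, Matrix.mul_apply]
  exact (mul_pos h1 h2).trans_le (Finset.single_le_sum (f := fun y => (P ^ j) s y * (P ^ k) y s')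
    (fun y _ => mul_nonneg (pow_entry_nonneg hP _ _ _) (pow_entry_nonneg hP _ _ _))
    (Finset.mem_univ x))

/-- Some power of an irreducible aperiodic matrix is entrywise positive. -/
theorem exists_pow_pos (hirr : P.IsIrreducible) (hap : IsAperiodic P) :
    ∃ N, ∀ s s', 0 < (P ^ N) s s' := by
  have hP := hirr.nonneg
  have hret : ∀ s, ∃ m, ∀ k ≥ m, 0 < (P ^ k) s s := by
    intro s
    -- Return times are closed under addition and have gcd 1, so they include all large integers.
    let R : Set ℕ := {k | 0 < k ∧ 0 < (P ^ k) s s}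
    have hg : Nat.setGcd R = 1 :=
      hap s _ fun k hk hpos => Nat.setGcd_dvd_of_mem (s := R) ⟨hk, hpos⟩
    obtain ⟨m, hm⟩ := Nat.exists_mem_closure_of_ge R
    refine ⟨m, fun k hk => ?_⟩
    refine AddSubmonoid.closure_induction (motive := fun k _ => 0 < (P ^ k) s s)
      (fun k hk => hk.2) ?_ (fun a b _ _ h1 h2 => pow_add_entry_pos hP h1 h2) (hm k hk (by simp [hg]))
    simp
  choose m hm using hret
  choose r _ hr using (Matrix.isIrreducible_iff_exists_pow_pos hP).1 hirr
  -- The two sums dominate every `m s + r s s'`: loop at `s` for the surplus time, then travel to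
  -- `s'`.
  refine ⟨∑ s, m s + ∑ s, ∑ s', r s s', fun s s' => ?_⟩
  have h1 : m s ≤ ∑ s, m s := Finset.single_le_sum (fun _ _ => Nat.zero_le _) (Finset.mem_univ s)
  have h2 : r s s' ≤ ∑ s, ∑ s', r s s' :=
    (Finset.single_le_sum (f := r s) (fun _ _ => Nat.zero_le _) (Finset.mem_univ s')).trans
      (Finset.single_le_sum (f := fun s => ∑ s', r s s') (fun _ _ => Nat.zero_le _)
        (Finset.mem_univ s))
  have := pow_add_entry_pos hP (hm s (∑ s, m s + ∑ s, ∑ s', r s s' - r s s') (by omega)) (hr s s')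
  rwa [Nat.sub_add_cancel (by omega)] at this

omit [DecidableEq S] in
/-- A positive stochastic matrix contracts the `ℓ¹` norm of vectors with sum zero. -/
theorem sum_abs_vecMul_le {Q : Matrix S S ℝ} {c : ℝ} (hc : ∀ s s', c ≤ Q s s')
    (hrow : ∀ s, ∑ s', Q s s' = 1) {v : S → ℝ} (hv : ∑ s, v s = 0) :
    ∑ s', |Matrix.vecMul v Q s'| ≤ (1 - Fintype.card S * c) * ∑ s, |v s| := by
  have h1 : ∀ s', |Matrix.vecMul v Q s'| ≤ ∑ s, |v s| * (Q s s' - c) := by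
    intro s'
    -- Since `v` has total mass zero, subtracting the constant `c` from `Q` changes nothing; what
    -- remains is nonnegative with smaller row sums.
    have : Matrix.vecMul v Q s' = ∑ s, v s * (Q s s' - c) := by
      simp only [mul_sub, Finset.sum_sub_distrib, ← Finset.sum_mul, hv, zero_mul, sub_zero]
      rfl
    rw [this]
    refine (Finset.abs_sum_le_sum_abs _ _).trans (Finset.sum_le_sum fun s _ => ?_)
    rw [abs_mul, abs_of_nonneg (sub_nonneg.2 (hc s s'))]
  refine (Finset.sum_le_sum fun s' _ => h1 s').trans (le_of_eq ?_)
  rw [Finset.sum_comm]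
  simp only [← Finset.mul_sum, Finset.sum_sub_distrib, hrow]
  simp [← Finset.sum_mul, mul_comm]

omit [DecidableEq S] in
theorem sum_vecMul {Q : Matrix S S ℝ} (hrow : ∀ s, ∑ s', Q s s' = 1) (v : S → ℝ) :
    ∑ s', Matrix.vecMul v Q s' = ∑ s, v s := by
  simp only [Matrix.vecMul, dotProduct]
  rw [Finset.sum_comm]
  simp only [← Finset.mul_sum, hrow, mul_one]

theorem vecMul_pow_of_fixed {v : S → ℝ} (hv : Matrix.vecMul v P = v) (k : ℕ) :
    Matrix.vecMul v (P ^ k) = v := by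
  induction k with
  | zero => simp
  | succ k ih => rw [pow_succ, ← Matrix.vecMul_vecMul, ih, hv]

/-- `P - 1` annihilates the constant vector on the right, so it is singular and has a left kernel
too. -/
theorem exists_fixed_vecMul [Nonempty S] (hrow : ∀ s, ∑ s', P s s' = 1) :
    ∃ v : S → ℝ, v ≠ 0 ∧ Matrix.vecMul v P = v := by
  have hdet : (P - 1).det = 0 := by
    rw [← Matrix.exists_mulVec_eq_zero_iff]
    refine ⟨fun _ => 1, fun h => one_ne_zero (congrFun h (Classical.arbitrary S)), ?_⟩
    ext s
    simp [Matrix.mulVec, dotProduct, Finset.sum_sub_distrib, hrow, Matrix.one_apply]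
  obtain ⟨v, hv0, hv⟩ := Matrix.exists_vecMul_eq_zero_iff.2 hdet
  refine ⟨v, hv0, ?_⟩
  rw [Matrix.vecMul_sub, Matrix.vecMul_one, sub_eq_zero] at hv
  exact hv

theorem eq_zero_of_fixed_of_sum_eq_zero {N : ℕ} {c : ℝ} (hc0 : 0 < c)
    (hc : ∀ s s', c ≤ (P ^ N) s s') (hrow : ∀ s, ∑ s', P s s' = 1) {v : S → ℝ}
    (hv : Matrix.vecMul v P = v) (hsum : ∑ s, v s = 0) : v = 0 := by
  have h := sum_abs_vecMul_le hc (pow_row_sum hrow N) hsum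
  rw [vecMul_pow_of_fixed hv] at h
  have h0 : 0 ≤ ∑ s, |v s| := Finset.sum_nonneg fun _ _ => abs_nonneg _
  funext s
  by_contra hs
  have hcard : 0 < (Fintype.card S : ℝ) := by
    have := Fintype.card_pos_iff.2 ⟨s⟩
    exact_mod_cast this
  have hpos : 0 < ∑ s, |v s| :=
    (abs_pos.2 hs).trans_le (Finset.single_le_sum (f := fun s => |v s|)
      (fun _ _ => abs_nonneg _) (Finset.mem_univ s))
  nlinarith [mul_pos (mul_pos hcard hc0) hpos]

/-- An irreducible aperiodic stochastic matrix has a unique stationary distribution, which is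
positive. -/
theorem exists_unique_stationary [Nonempty S]
    (hrow : ∀ s, ∑ s', P s s' = 1) {N : ℕ} (hN : ∀ s s', 0 < (P ^ N) s s') :
    ∃ κ : S → ℝ, (∀ κ', IsStationaryDist P κ' ↔ κ' = κ) ∧ ∀ s, 0 < κ s := by
  obtain ⟨c, hc0, hc⟩ : ∃ c : ℝ, 0 < c ∧ ∀ s s', c ≤ (P ^ N) s s' := by
    obtain ⟨q, hq⟩ := Finite.exists_min fun q : S × S => (P ^ N) q.1 q.2
    exact ⟨_, hN q.1 q.2, fun s s' => hq (s, s')⟩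
  obtain ⟨v, hv0, hv⟩ := exists_fixed_vecMul hrow
  have hsum : ∑ s, v s ≠ 0 := fun h =>
    hv0 (eq_zero_of_fixed_of_sum_eq_zero hc0 hc hrow hv h)
  set w : S → ℝ := fun s => (∑ x, v x)⁻¹ * v s with hw
  have hwP : Matrix.vecMul w P = w := by
    have : w = (∑ x, v x)⁻¹ • v := rfl
    rw [this, Matrix.smul_vecMul, hv]
  have hwsum : ∑ s, w s = 1 := by
    rw [hw, ← Finset.mul_sum, inv_mul_cancel₀ hsum]
  have hwN := vecMul_pow_of_fixed hwP N
  have hle : ∀ s', |w s'| ≤ Matrix.vecMul (fun s => |w s|) (P ^ N) s' := by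
    intro s'
    calc |w s'| = |∑ s, w s * (P ^ N) s s'| := by
          conv_lhs => rw [← hwN]
          rfl
      _ ≤ ∑ s, |w s * (P ^ N) s s'| := Finset.abs_sum_le_sum_abs _ _
      _ = _ := Finset.sum_congr rfl fun s _ => by rw [abs_mul, abs_of_pos (hN s s')]
  -- Both sides of `hle` have the same total mass, so the pointwise inequality is an equality.
  have habs : Matrix.vecMul (fun s => |w s|) (P ^ N) = fun s => |w s| := by
    funext s'
    refine ((Finset.sum_eq_sum_iff_of_le fun s' _ => hle s').1 ?_ s' (Finset.mem_univ s')).symm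
    rw [sum_vecMul (pow_row_sum hrow N)]
  have hpos : 0 < ∑ s, |w s| := by
    have : (1 : ℝ) ≤ ∑ s, |w s| := hwsum ▸ Finset.sum_le_sum fun s _ => le_abs_self _
    linarith
  have hw0 : ∀ s, 0 ≤ w s := by
    -- `w` and the normalized `|w|` are both fixed by `P ^ N` with mass one; their difference is
    -- fixed with mass zero, hence zero. Thus `w` is nonnegative.
    have h0 : w - (∑ s, |w s|)⁻¹ • (fun s => |w s|) = 0 := by
      refine eq_zero_of_fixed_of_sum_eq_zero (P := P ^ N) (N := 1) hc0 (by simpa using hc)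
        (pow_row_sum hrow N) ?_ ?_
      · rw [Matrix.sub_vecMul, Matrix.smul_vecMul, habs, hwN]
      · simp only [Pi.sub_apply, Pi.smul_apply, smul_eq_mul, Finset.sum_sub_distrib,
          ← Finset.mul_sum, hwsum, inv_mul_cancel₀ hpos.ne', sub_self]
    intro s
    have := congrFun h0 s
    simp only [Pi.sub_apply, Pi.smul_apply, smul_eq_mul, Pi.zero_apply, sub_eq_zero] at this
    rw [this]
    positivity
  refine ⟨w, fun κ' => ⟨fun h => ?_, ?_⟩, fun s => ?_⟩
  · refine sub_eq_zero.1 (eq_zero_of_fixed_of_sum_eq_zero hc0 hc hrow ?_ ?_)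
    · rw [Matrix.sub_vecMul, h.2, hwP]
    · simp [Finset.sum_sub_distrib, hwsum, h.1.2]
  · rintro rfl
    exact ⟨⟨hw0, hwsum⟩, hwP⟩
  · calc 0 < c := hc0
      _ = ∑ x, w x * c := by rw [← Finset.sum_mul, hwsum, one_mul]
      _ ≤ ∑ x, w x * (P ^ N) x s :=
          Finset.sum_le_sum fun x _ => mul_le_mul_of_nonneg_left (hc x s) (hw0 x)
      _ = w s := congrFun hwN s

theorem exists_pow_sum_abs_sub_le (hP : ∀ s s', 0 ≤ P s s')
    (hrow : ∀ s, ∑ s', P s s' = 1) {N : ℕ} (hN : ∀ s s', 0 < (P ^ N) s s') {κ : S → ℝ}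
    (hκ : IsStationaryDist P κ) :
    ∃ q : ℝ, 0 < q ∧ q < 1 ∧ ∀ r s, ∑ s', |(P ^ (N * r)) s s' - κ s'| ≤ 2 * q ^ r := by
  obtain ⟨c, hc0, hc⟩ : ∃ c : ℝ, 0 < c ∧ ∀ s s', c ≤ (P ^ N) s s' := by
    rcases isEmpty_or_nonempty S with h | h
    · exact ⟨1, one_pos, fun s => h.elim s⟩
    obtain ⟨q, hq⟩ := Finite.exists_min fun q : S × S => (P ^ N) q.1 q.2
    exact ⟨_, hN q.1 q.2, fun s s' => hq (s, s')⟩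
  -- The floor `1 / 2` keeps `q` positive, so that log(1/q) can later be divided by.
  set q : ℝ := max (1 / 2) (1 - Fintype.card S * c)
  rcases isEmpty_or_nonempty S with h | h
  · exact ⟨1 / 2, by norm_num, by norm_num, fun r s => h.elim s⟩
  have hcard : 0 < (Fintype.card S : ℝ) := by exact_mod_cast Fintype.card_pos
  refine ⟨q, by positivity, max_lt (by norm_num) (by nlinarith [mul_pos hcard hc0]),
    fun r s => ?_⟩
  induction r with
  | zero =>
    calc ∑ s', |(P ^ (N * 0)) s s' - κ s'|
        ≤ ∑ s', ((P ^ (N * 0)) s s' + κ s') := Finset.sum_le_sum fun s' _ => by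
          have h1 := hκ.1.1 s'
          have h2 := pow_entry_nonneg hP (N * 0) s s'
          rw [abs_le]
          constructor <;> linarith
      _ = 2 * q ^ 0 := by
          rw [Finset.sum_add_distrib, pow_row_sum hrow, hκ.1.2]
          norm_num
  | succ r ih =>
    set v : S → ℝ := fun s' => (P ^ (N * r)) s s' - κ s'
    have hv : ∑ s', v s' = 0 := by
      simp [v, Finset.sum_sub_distrib, pow_row_sum hrow, hκ.1.2]
    have hstep : ∀ s', (P ^ (N * (r + 1))) s s' - κ s' = Matrix.vecMul v (P ^ N) s' := by
      intro s'
      have h1 : v = (P ^ (N * r)) s - κ := rfl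
      rw [h1, Matrix.sub_vecMul, vecMul_pow_of_fixed hκ.2, mul_add, mul_one, pow_add]
      rfl
    simp only [hstep]
    refine (sum_abs_vecMul_le hc (pow_row_sum hrow N) hv).trans ?_
    calc (1 - Fintype.card S * c) * ∑ s, |v s| ≤ q * ∑ s, |v s| :=
          mul_le_mul_of_nonneg_right (le_max_right _ _)
            (Finset.sum_nonneg fun _ _ => abs_nonneg _)
      _ ≤ q * (2 * q ^ r) := mul_le_mul_of_nonneg_left ih (by positivity)
      _ = 2 * q ^ (r + 1) := by ring

theorem exists_isMixingConst (hP : ∀ s s', 0 ≤ P s s')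
    (hrow : ∀ s, ∑ s', P s s' = 1) {N : ℕ} (hN : ∀ s s', 0 < (P ^ N) s s') {κ : S → ℝ}
    (hκ : IsStationaryDist P κ) : ∃ L, IsMixingConst P κ L := by
  obtain ⟨q, hq0, hq1, hq⟩ := exists_pow_sum_abs_sub_le hP hrow hN hκ
  have hlq : 0 < Real.log (1 / q) := Real.log_pos (by rw [lt_div_iff₀ hq0]; linarith)
  refine ⟨N * max 1 (1 / Real.log (1 / q)), fun δ hδ hδ1 => ?_⟩
  have hlδ : 0 ≤ Real.log (1 / δ) := Real.log_nonneg (by rw [le_div_iff₀ hδ]; linarith)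
  set r := ⌈Real.log (1 / δ) / Real.log (1 / q)⌉₊
  have hr : q ^ r ≤ δ := by
    have h1 : Real.log (1 / δ) ≤ r * Real.log (1 / q) := by
      rw [← div_le_iff₀ hlq]
      exact Nat.le_ceil _
    rw [← Real.log_le_log_iff (by positivity) hδ, Real.log_pow]
    simp only [one_div, Real.log_inv] at h1
    linarith
  have hmix : mixingTime P κ δ ≤ N * r := by
    refine Nat.sInf_le fun s => ?_
    rw [tvDist]
    linarith [hq r s]
  calc (mixingTime P κ δ : ℝ) ≤ N * r := by exact_mod_cast hmix
    _ ≤ N * (max 1 (1 / Real.log (1 / q)) * (Real.log (1 / δ) + 1)) := by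
        refine mul_le_mul_of_nonneg_left ?_ (Nat.cast_nonneg _)
        have h1 : (r : ℝ) ≤ Real.log (1 / δ) / Real.log (1 / q) + 1 :=
          (Nat.ceil_lt_add_one (by positivity)).le
        have h2 := le_max_left 1 (1 / Real.log (1 / q))
        have h3 := mul_le_mul_of_nonneg_right (le_max_right 1 (1 / Real.log (1 / q))) hlδ
        rw [div_eq_mul_one_div, mul_comm] at h1
        linarith
    _ = _ := by ring

/-- Geometric convergence makes the set defining the infimum nonempty, so `sInf` is attained rather
than the default 0. One entry differs by at most the ℓ¹ distance, which is twice the total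
variation. -/
theorem mixingTime_spec (hP : ∀ s s', 0 ≤ P s s')
    (hrow : ∀ s, ∑ s', P s s' = 1) {N : ℕ} (hN : ∀ s s', 0 < (P ^ N) s s') {κ : S → ℝ}
    (hκ : IsStationaryDist P κ) {δ : ℝ} (hδ : 0 < δ) (s s' : S) :
    |(P ^ mixingTime P κ δ) s s' - κ s'| ≤ 2 * δ := by
  obtain ⟨q, hq0, hq1, hq⟩ := exists_pow_sum_abs_sub_le hP hrow hN hκ
  obtain ⟨r, hr⟩ := exists_pow_lt_of_lt_one hδ hq1
  have hmem : mixingTime P κ δ ∈ {k : ℕ | ∀ s, tvDist ((P ^ k) s) κ ≤ δ} := by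
    refine Nat.sInf_mem ⟨N * r, fun s => ?_⟩
    rw [tvDist]
    linarith [hq r s]
  have h1 : 1 / 2 * ∑ x, |(P ^ mixingTime P κ δ) s x - κ x| ≤ δ := hmem s
  have h2 : |(P ^ mixingTime P κ δ) s s' - κ s'| ≤ ∑ x, |(P ^ mixingTime P κ δ) s x - κ x| :=
    Finset.single_le_sum (f := fun x => |(P ^ mixingTime P κ δ) s x - κ x|)
      (fun _ _ => abs_nonneg _) (Finset.mem_univ s')
  linarith

end FiniteChains

/-! ### The mean n-step operator and its sup-norm contraction. -/

section Operators

variable {S A : Type*} [Fintype S] [Fintype A] (M : MDP S A)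

theorem MDP.trans_nonneg (π : Policy S A) (s s' : S) : 0 ≤ M.trans π s s' :=
  Finset.sum_nonneg fun a _ => mul_nonneg (π.nonneg s a) (M.P_nonneg a s s')

theorem MDP.trans_row_sum (π : Policy S A) (s : S) : ∑ s', M.trans π s s' = 1 := by
  simp only [MDP.trans]
  rw [Finset.sum_comm]
  simp only [← Finset.mul_sum, M.P_sum, mul_one, π.sum_eq_one]

theorem MDP.meanReward_nonneg (π : Policy S A) (s : S) : 0 ≤ M.meanReward π s :=
  Finset.sum_nonneg fun a _ => mul_nonneg (π.nonneg s a) (M.reward_nonneg s a)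

theorem MDP.meanReward_le_one (π : Policy S A) (s : S) : M.meanReward π s ≤ 1 := by
  rw [← π.sum_eq_one s]
  exact Finset.sum_le_sum fun a _ => mul_le_of_le_one_right (π.nonneg s a) (M.reward_le_one s a)

theorem abs_sum_mul_le {ι : Type*} [Fintype ι] {w v : ι → ℝ} {b : ℝ} (hw : ∀ i, 0 ≤ w i)
    (hv : ∀ i, |v i| ≤ b) : |∑ i, w i * v i| ≤ (∑ i, w i) * b := by
  rw [Finset.sum_mul]
  refine (Finset.abs_sum_le_sum_abs _ _).trans (Finset.sum_le_sum fun i _ => ?_)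
  rw [abs_mul, abs_of_nonneg (hw i)]
  exact mul_le_mul_of_nonneg_left (hv i) (hw i)

theorem abs_apply_le_norm (v : S → ℝ) (s : S) : |v s| ≤ ‖v‖ := norm_le_pi_norm v s

section Value

variable [DecidableEq S]

theorem MDP.abs_sum_pow_mul_meanReward_le (π : Policy S A) (k : ℕ) (s : S) :
    |∑ x, (M.trans π ^ k) s x * M.meanReward π x| ≤ 1 := by
  have h := abs_sum_mul_le (b := 1) (pow_entry_nonneg (M.trans_nonneg π) k s)
    (v := M.meanReward π) fun x => by
      rw [abs_of_nonneg (M.meanReward_nonneg π x)]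
      exact M.meanReward_le_one π x
  rwa [pow_row_sum (M.trans_row_sum π), one_mul] at h

theorem MDP.summable_value (π : Policy S A) (s : S) :
    Summable fun k : ℕ => M.γ ^ k * ∑ x, (M.trans π ^ k) s x * M.meanReward π x := by
  refine Summable.of_norm_bounded (summable_geometric_of_lt_one M.γ_pos.le M.γ_lt_one) fun k => ?_
  rw [Real.norm_eq_abs, abs_mul, abs_of_nonneg (pow_nonneg M.γ_pos.le k)]
  exact mul_le_of_le_one_right (pow_nonneg M.γ_pos.le k) (M.abs_sum_pow_mul_meanReward_le π k s)

theorem MDP.norm_value_le (π : Policy S A) : ‖M.value π‖ ≤ 1 / (1 - M.γ) := by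
  have hγ : 0 < 1 - M.γ := sub_pos.2 M.γ_lt_one
  rw [pi_norm_le_iff_of_nonneg (by positivity), one_div]
  intro s
  refine tsum_of_norm_bounded (hasSum_geometric_of_lt_one M.γ_pos.le M.γ_lt_one) fun k => ?_
  rw [Real.norm_eq_abs, abs_mul, abs_of_nonneg (pow_nonneg M.γ_pos.le k)]
  exact mul_le_of_le_one_right (pow_nonneg M.γ_pos.le k) (M.abs_sum_pow_mul_meanReward_le π k s)

/-- The Bellman equation for the value function. -/
theorem MDP.value_eq (π : Policy S A) (s : S) :
    M.value π s = M.meanReward π s + M.γ * ∑ s', M.trans π s s' * M.value π s' := by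
  have h1 : HasSum (fun k : ℕ => M.γ * ∑ s', M.trans π s s' *
      (M.γ ^ k * ∑ x, (M.trans π ^ k) s' x * M.meanReward π x))
      (M.γ * ∑ s', M.trans π s s' * M.value π s') :=
    (hasSum_sum fun s' _ => (M.summable_value π s').hasSum.mul_left _).mul_left _
  have h2 : ∀ k : ℕ, M.γ ^ (k + 1) * ∑ x, (M.trans π ^ (k + 1)) s x * M.meanReward π x =
      M.γ * ∑ s', M.trans π s s' *
        (M.γ ^ k * ∑ x, (M.trans π ^ k) s' x * M.meanReward π x) := by
    intro k
    simp only [pow_succ' (M.trans π), Matrix.mul_apply, Finset.sum_mul, Finset.mul_sum]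
    rw [Finset.sum_comm]
    refine Finset.sum_congr rfl fun s' _ => Finset.sum_congr rfl fun x _ => ?_
    ring
  rw [MDP.value, (M.summable_value π s).tsum_eq_zero_add]
  simp only [h2, h1.tsum_eq]
  congr 1
  simp [Matrix.one_apply]

end Value

variable (πb π : Policy S A) (cbar : ℝ)

/-- Substochastic transition matrix weighted by the truncated importance sampling ratios. -/
noncomputable def MDP.truncTrans : Matrix S S ℝ :=
  fun s s' => ∑ a, πb.prob s a * truncRatio πb π cbar s a * M.P a s s'

variable {πb cbar}

theorem prob_mul_truncRatio (hπb : ∀ s a, 0 < πb.prob s a) (s : S) (a : A) :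
    πb.prob s a * truncRatio πb π cbar s a = min (cbar * πb.prob s a) (π.prob s a) := by
  rw [truncRatio, mul_min_of_nonneg _ _ (hπb s a).le, mul_div_cancel₀ _ (hπb s a).ne', mul_comm]

theorem truncRatio_nonneg (hπb : ∀ s a, 0 < πb.prob s a) (hc : 0 ≤ cbar) (s : S) (a : A) :
    0 ≤ truncRatio πb π cbar s a :=
  le_min hc (div_nonneg (π.nonneg s a) (hπb s a).le)

theorem MDP.truncTrans_nonneg (hπb : ∀ s a, 0 < πb.prob s a) (hc : 0 ≤ cbar) (s s' : S) :
    0 ≤ M.truncTrans πb π cbar s s' :=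
  Finset.sum_nonneg fun a _ => mul_nonneg
    (mul_nonneg (hπb s a).le (truncRatio_nonneg π hπb hc s a)) (M.P_nonneg a s s')

theorem MDP.truncTrans_le_trans (hπb : ∀ s a, 0 < πb.prob s a) (s s' : S) :
    M.truncTrans πb π cbar s s' ≤ M.trans π s s' := by
  refine Finset.sum_le_sum fun a _ => mul_le_mul_of_nonneg_right ?_ (M.P_nonneg a s s')
  rw [prob_mul_truncRatio π hπb]
  exact min_le_right _ _

theorem Cmin_le (s : S) :
    Cmin πb π cbar ≤ ∑ a, min (cbar * πb.prob s a) (π.prob s a) :=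
  ciInf_le (Set.finite_range _).bddBelow s

theorem Cmin_nonneg [Nonempty S] (hc : 0 ≤ cbar) : 0 ≤ Cmin πb π cbar :=
  le_ciInf fun s => Finset.sum_nonneg fun a _ =>
    le_min (mul_nonneg hc (πb.nonneg s a)) (π.nonneg s a)

theorem Cmin_le_one [Nonempty S] : Cmin πb π cbar ≤ 1 := by
  refine (Cmin_le π (Classical.arbitrary S)).trans ?_
  rw [← π.sum_eq_one (Classical.arbitrary S)]
  exact Finset.sum_le_sum fun a _ => min_le_right _ _

theorem MDP.Cmin_le_truncTrans_row_sum (hπb : ∀ s a, 0 < πb.prob s a) (s : S) :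
    Cmin πb π cbar ≤ ∑ s', M.truncTrans πb π cbar s s' := by
  refine (Cmin_le π s).trans (le_of_eq ?_)
  simp only [MDP.truncTrans]
  rw [Finset.sum_comm]
  simp only [← Finset.mul_sum, M.P_sum, mul_one, prob_mul_truncRatio π hπb]

/-- The linear part of the mean `n`-step V-trace correction. -/
noncomputable def MDP.meanUpdate (M : MDP S A) (πb π : Policy S A) (cbar : ℝ) : ℕ → (S → ℝ) →ₗ[ℝ] (S → ℝ)
  | 0 => 0
  | n + 1 => M.γ • (M.trans π).mulVecLin - LinearMap.id +
      M.γ • (M.truncTrans πb π cbar).mulVecLin ∘ₗ M.meanUpdate πb π cbar n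

variable (πb cbar) in
theorem MDP.meanUpdate_succ (n : ℕ) (v : S → ℝ) (s : S) :
    M.meanUpdate πb π cbar (n + 1) v s = M.γ * ∑ s', M.trans π s s' * v s' - v s +
      M.γ * ∑ s', M.truncTrans πb π cbar s s' * M.meanUpdate πb π cbar n v s' := rfl

theorem MDP.sum_geom_Cmin_le (n : ℕ) [Nonempty S] (hc : 0 ≤ cbar) :
    (1 - M.γ) * ∑ i ∈ Finset.range n, (M.γ * Cmin πb π cbar) ^ i ≤ 1 := by
  have hγ := M.γ_pos
  have hγ1 := M.γ_lt_one
  have hC0 := Cmin_nonneg (πb := πb) π hc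
  have hC1 := Cmin_le_one (πb := πb) π (cbar := cbar)
  induction n with
  | zero => simp
  | succ n ih =>
    rw [geom_sum_succ]
    nlinarith [mul_le_mul_of_nonneg_left ih (mul_nonneg hγ.le hC0),
      mul_le_mul_of_nonneg_left hC1 hγ.le]

/-- With T_n the mean update, v + T_{n+1} v = γ [(P_π − P_c) v + P_c (v + T_n v)]. Both matrices are
nonnegative with joint row mass 1, and P_c, of row mass at least C_min, inherits the contraction of
n steps. The factor 1 − (1 − γ) d_n thus becomes at most γ − γ C_min (1 − γ) d_n, which is the claim
for d_{n+1} = 1 + γ C_min d_n. -/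
theorem MDP.abs_add_meanUpdate_le [Nonempty S] (hπb : ∀ s a, 0 < πb.prob s a) (hc : 0 ≤ cbar)
    (n : ℕ) (v : S → ℝ) (s : S) :
    |v s + M.meanUpdate πb π cbar n v s| ≤
      (1 - (1 - M.γ) * ∑ i ∈ Finset.range n, (M.γ * Cmin πb π cbar) ^ i) * ‖v‖ := by
  induction n generalizing s with
  | zero => simpa [MDP.meanUpdate] using abs_apply_le_norm v s
  | succ n ih =>
    set d := ∑ i ∈ Finset.range n, (M.γ * Cmin πb π cbar) ^ i
    have hγ := M.γ_pos
    have hγ1 := M.γ_lt_one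
    have hd : 0 ≤ d := Finset.sum_nonneg fun i _ =>
      pow_nonneg (mul_nonneg hγ.le (Cmin_nonneg π hc)) i
    have h1 := abs_sum_mul_le (w := fun s' => M.trans π s s' - M.truncTrans πb π cbar s s')
      (fun s' => sub_nonneg.2 (M.truncTrans_le_trans π hπb s s')) (abs_apply_le_norm v)
    have h2 := abs_sum_mul_le (M.truncTrans_nonneg π hπb hc s) ih
    have h3 := M.Cmin_le_truncTrans_row_sum π hπb s (cbar := cbar)
    rw [Finset.sum_sub_distrib, M.trans_row_sum] at h1
    have e : v s + M.meanUpdate πb π cbar (n + 1) v s = M.γ *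
        (∑ s', (M.trans π s s' - M.truncTrans πb π cbar s s') * v s' +
          ∑ s', M.truncTrans πb π cbar s s' * (v s' + M.meanUpdate πb π cbar n v s')) := by
      rw [MDP.meanUpdate_succ]
      simp only [sub_mul, mul_add, Finset.sum_sub_distrib, Finset.sum_add_distrib]
      ring
    rw [e, abs_mul, abs_of_pos hγ, geom_sum_succ]
    have h4 := (abs_add_le _ _).trans (add_le_add h1 h2)
    refine (mul_le_mul_of_nonneg_left h4 hγ.le).trans ?_
    have h5 : 0 ≤ M.γ * ((1 - M.γ) * d) * ‖v‖ := by
      have : 0 ≤ 1 - M.γ := by linarith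
      positivity
    nlinarith [mul_le_mul_of_nonneg_right h3 h5]

theorem MDP.norm_meanUpdate_le [Nonempty S] (hπb : ∀ s a, 0 < πb.prob s a) (hc : 0 ≤ cbar)
    (n : ℕ) (v : S → ℝ) : ‖M.meanUpdate πb π cbar n v‖ ≤ 2 * ‖v‖ := by
  rw [pi_norm_le_iff_of_nonneg (by positivity)]
  intro s
  have h1 := M.abs_add_meanUpdate_le π hπb hc n v s
  have h2 := abs_apply_le_norm v s
  have h3 : 0 ≤ (1 - M.γ) * ∑ i ∈ Finset.range n, (M.γ * Cmin πb π cbar) ^ i :=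
    mul_nonneg (sub_nonneg.2 M.γ_lt_one.le) (Finset.sum_nonneg fun i _ =>
      pow_nonneg (mul_nonneg M.γ_pos.le (Cmin_nonneg π hc)) i)
  rw [Real.norm_eq_abs]
  rw [abs_le] at *
  constructor <;> nlinarith [mul_nonneg h3 (norm_nonneg v)]

end Operators

/-! ### The random correction: size, Lipschitz constant and conditional mean. -/

section Correction

variable {S A : Type*} [Fintype S] [Fintype A] (M : MDP S A) (πb π : Policy S A) (cbar ρbar : ℝ)

/-- The `n`-step V-trace correction at time `k` along the states `x` and actions `y`. -/
noncomputable def MDP.correction (V : S → ℝ) (x : ℕ → S) (y : ℕ → A) (n k : ℕ) : ℝ :=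
  ∑ i ∈ Finset.range n, M.γ ^ i *
    (∏ j ∈ Finset.range i, truncRatio πb π cbar (x (k + j)) (y (k + j))) *
    truncRatio πb π ρbar (x (k + i)) (y (k + i)) *
    M.tempDiff V (x (k + i)) (y (k + i)) (x (k + i + 1))

theorem MDP.correction_succ (V : S → ℝ) (x : ℕ → S) (y : ℕ → A) (n k : ℕ) :
    M.correction πb π cbar ρbar V x y (n + 1) k =
      truncRatio πb π ρbar (x k) (y k) * M.tempDiff V (x k) (y k) (x (k + 1)) +
        M.γ * truncRatio πb π cbar (x k) (y k) *
          M.correction πb π cbar ρbar V x y n (k + 1) := by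
  rw [MDP.correction, Finset.sum_range_succ', add_comm, MDP.correction, Finset.mul_sum]
  congr 1
  · simp
  · refine Finset.sum_congr rfl fun i _ => ?_
    rw [Finset.prod_range_succ']
    have h : ∀ j, k + 1 + j = k + (j + 1) := fun j => by omega
    simp only [h, add_zero, pow_succ]
    ring

theorem iterate_succ_eq [DecidableEq S] (n : ℕ) (α : ℝ) (V₀ : S → ℝ) (x : ℕ → S) (y : ℕ → A)
    (k : ℕ) :
    iterate M πb π n cbar ρbar (fun _ => α) V₀ x y (k + 1) =
      iterate M πb π n cbar ρbar (fun _ => α) V₀ x y k + α • Pi.single (x k)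
        (M.correction πb π cbar ρbar (iterate M πb π n cbar ρbar (fun _ => α) V₀ x y k) x y n k) := by
  funext s
  rw [iterate]
  rw [Pi.add_apply, Pi.smul_apply, smul_eq_mul]
  by_cases h : s = x k
  · subst h
    rw [Pi.single_eq_same]
    exact if_pos rfl
  · rw [Pi.single_eq_of_ne h, mul_zero, add_zero]
    exact if_neg h

variable {πb cbar ρbar}

/-- The value `n` at `γ * cbar = 1` is exactly the geometric sum, so later arguments need no case
split. -/
theorem eta_eq_sum (n : ℕ) (γ cbar : ℝ) :
    eta n γ cbar = ∑ i ∈ Finset.range n, (γ * cbar) ^ i := by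
  rw [eta]
  split_ifs with h
  · simp [h]
  · rw [geom_sum_eq h, ← neg_div_neg_eq]
    simp

theorem one_le_eta {n : ℕ} (hn : 1 ≤ n) {γ cbar : ℝ} (h : 0 ≤ γ * cbar) : 1 ≤ eta n γ cbar := by
  rw [eta_eq_sum]
  have := Finset.single_le_sum (f := fun i => (γ * cbar) ^ i) (fun i _ => pow_nonneg h i)
    (Finset.mem_range.2 hn)
  simpa using this

theorem MDP.abs_weighted_sum_le (hπb : ∀ s a, 0 < πb.prob s a) (hc : 0 ≤ cbar) (hρ : 0 ≤ ρbar)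
    (x : ℕ → S) (y : ℕ → A) (n k : ℕ) (f : ℕ → ℝ) (τ : ℝ) (hf : ∀ i, |f i| ≤ τ) :
    |∑ i ∈ Finset.range n, M.γ ^ i *
      (∏ j ∈ Finset.range i, truncRatio πb π cbar (x (k + j)) (y (k + j))) *
      truncRatio πb π ρbar (x (k + i)) (y (k + i)) * f i| ≤ ρbar * eta n M.γ cbar * τ := by
  have hγ := M.γ_pos
  rw [eta_eq_sum, Finset.mul_sum, Finset.sum_mul]
  refine (Finset.abs_sum_le_sum_abs _ _).trans (Finset.sum_le_sum fun i _ => ?_)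
  have h1 : 0 ≤ ∏ j ∈ Finset.range i, truncRatio πb π cbar (x (k + j)) (y (k + j)) :=
    Finset.prod_nonneg fun j _ => truncRatio_nonneg π hπb hc _ _
  have h2 : ∏ j ∈ Finset.range i, truncRatio πb π cbar (x (k + j)) (y (k + j)) ≤ cbar ^ i := by
    have := Finset.prod_le_prod (s := Finset.range i)
      (fun j _ => truncRatio_nonneg π hπb hc (x (k + j)) (y (k + j)))
      (fun j _ => min_le_left cbar (π.prob (x (k + j)) (y (k + j)) / πb.prob (x (k + j)) (y (k + j))))
    simpa using this
  have h3 := truncRatio_nonneg π hπb hρ (x (k + i)) (y (k + i))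
  have h4 : truncRatio πb π ρbar (x (k + i)) (y (k + i)) ≤ ρbar := min_le_left _ _
  rw [abs_mul, abs_of_nonneg (by positivity), mul_pow]
  calc _ ≤ M.γ ^ i * cbar ^ i * ρbar * τ := by
        gcongr
        exact hf i
    _ = _ := by ring

theorem MDP.abs_correction_le (hπb : ∀ s a, 0 < πb.prob s a) (hc : 0 ≤ cbar) (hρ : 0 ≤ ρbar)
    (V : S → ℝ) (x : ℕ → S) (y : ℕ → A) (n k : ℕ) :
    |M.correction πb π cbar ρbar V x y n k| ≤ ρbar * eta n M.γ cbar * (1 + 2 * ‖V‖) := by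
  refine M.abs_weighted_sum_le π hπb hc hρ x y n k _ _ fun i => ?_
  rw [MDP.tempDiff]
  have h1 := abs_apply_le_norm V (x (k + i + 1))
  have h2 := abs_apply_le_norm V (x (k + i))
  have h3 := M.reward_nonneg (x (k + i)) (y (k + i))
  have h4 := M.reward_le_one (x (k + i)) (y (k + i))
  have hγ := M.γ_pos
  have hγ1 := M.γ_lt_one
  have h5 := norm_nonneg V
  rw [abs_le] at *
  constructor <;> nlinarith

theorem MDP.abs_correction_sub_le (hπb : ∀ s a, 0 < πb.prob s a) (hc : 0 ≤ cbar) (hρ : 0 ≤ ρbar)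
    (V W : S → ℝ) (x : ℕ → S) (y : ℕ → A) (n k : ℕ) :
    |M.correction πb π cbar ρbar V x y n k - M.correction πb π cbar ρbar W x y n k| ≤
      ρbar * eta n M.γ cbar * (2 * ‖V - W‖) := by
  rw [MDP.correction, MDP.correction, ← Finset.sum_sub_distrib]
  simp only [← mul_sub]
  refine M.abs_weighted_sum_le π hπb hc hρ x y n k _ _ fun i => ?_
  have h1 := abs_apply_le_norm (V - W) (x (k + i + 1))
  have h2 := abs_apply_le_norm (V - W) (x (k + i))
  have hγ := M.γ_pos
  have hγ1 := M.γ_lt_one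
  have h5 := norm_nonneg (V - W)
  simp only [MDP.tempDiff, Pi.sub_apply] at *
  rw [abs_le] at *
  constructor <;> nlinarith

/-- The conditional mean of the `n`-step correction given the current state and action. -/
noncomputable def MDP.condMean (M : MDP S A) (πb π : Policy S A) (cbar ρbar : ℝ) (V : S → ℝ) : ℕ → S → A → ℝ
  | 0, _, _ => 0
  | n + 1, s, a => ∑ s', M.P a s s' * ∑ a', πb.prob s' a' *
      (truncRatio πb π ρbar s a * M.tempDiff V s a s' +
        M.γ * truncRatio πb π cbar s a * M.condMean πb π cbar ρbar V n s' a')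

/-- Since `ρbar` does not truncate, importance weighting turns π_b into π in each temporal
difference. The Bellman equation then cancels the reward, and only the linear action on V − V_π is
left. -/
theorem MDP.sum_prob_mul_condMean [DecidableEq S] (hπb : ∀ s a, 0 < πb.prob s a)
    (hρ : ∀ s a, π.prob s a / πb.prob s a ≤ ρbar) (V : S → ℝ) (n : ℕ) (s : S) :
    ∑ a, πb.prob s a * M.condMean πb π cbar ρbar V n s a =
      M.meanUpdate πb π cbar n (V - M.value π) s := by
  induction n generalizing s with
  | zero => simp [MDP.condMean, MDP.meanUpdate]
  | succ n ih =>
    have h1 : ∀ a, πb.prob s a * M.condMean πb π cbar ρbar V (n + 1) s a =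
        π.prob s a * M.reward s a + M.γ * ∑ s', π.prob s a * M.P a s s' * V s' -
          π.prob s a * V s + M.γ * ∑ s', πb.prob s a * truncRatio πb π cbar s a * M.P a s s' *
            M.meanUpdate πb π cbar n (V - M.value π) s' := by
      intro a
      have hr : truncRatio πb π ρbar s a = π.prob s a / πb.prob s a := min_eq_right (hρ s a)
      have h2 : ∀ s', ∑ a', πb.prob s' a' *
          (truncRatio πb π ρbar s a * M.tempDiff V s a s' +
            M.γ * truncRatio πb π cbar s a * M.condMean πb π cbar ρbar V n s' a') =
          truncRatio πb π ρbar s a * M.tempDiff V s a s' +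
            M.γ * truncRatio πb π cbar s a * M.meanUpdate πb π cbar n (V - M.value π) s' := by
        intro s'
        rw [← ih]
        simp only [mul_add, Finset.sum_add_distrib, ← Finset.sum_mul, πb.sum_eq_one, one_mul]
        congr 1
        rw [Finset.mul_sum]
        exact Finset.sum_congr rfl fun a' _ => by ring
      have h3 : πb.prob s a * truncRatio πb π ρbar s a = π.prob s a := by
        rw [hr, mul_div_cancel₀ _ (hπb s a).ne']
      have h4 : ∀ s', πb.prob s a * (M.P a s s' * (truncRatio πb π ρbar s a *
            M.tempDiff V s a s' + M.γ * truncRatio πb π cbar s a *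
              M.meanUpdate πb π cbar n (V - M.value π) s')) =
          M.P a s s' * (π.prob s a * M.reward s a) + M.γ * (π.prob s a * M.P a s s' * V s') -
            M.P a s s' * (π.prob s a * V s) +
            M.γ * (πb.prob s a * truncRatio πb π cbar s a * M.P a s s' *
              M.meanUpdate πb π cbar n (V - M.value π) s') := by
        intro s'
        rw [MDP.tempDiff, ← h3]
        ring
      rw [MDP.condMean]
      simp only [h2]
      rw [Finset.mul_sum]
      simp only [h4, Finset.sum_add_distrib, Finset.sum_sub_distrib, ← Finset.mul_sum,
        ← Finset.sum_mul, M.P_sum, one_mul]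
    rw [MDP.meanUpdate_succ]
    simp only [h1, Finset.sum_add_distrib, Finset.sum_sub_distrib, ← Finset.sum_mul,
      ← Finset.mul_sum, π.sum_eq_one, one_mul, Pi.sub_apply, mul_sub]
    have h5 := M.value_eq π s
    rw [MDP.meanReward] at h5
    rw [h5]
    have h6 : ∀ f : S → ℝ, ∑ a, ∑ s', π.prob s a * M.P a s s' * f s' =
        ∑ s', M.trans π s s' * f s' := by
      intro f
      rw [Finset.sum_comm]
      simp only [MDP.trans, Finset.sum_mul]
    have h7 : ∑ a, ∑ s', πb.prob s a * truncRatio πb π cbar s a * M.P a s s' *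
        M.meanUpdate πb π cbar n (V - M.value π) s' = ∑ s', M.truncTrans πb π cbar s s' *
          M.meanUpdate πb π cbar n (V - M.value π) s' := by
      rw [Finset.sum_comm]
      simp only [MDP.truncTrans, Finset.sum_mul]
    rw [h6, h7]
    ring

end Correction

/-! ### Integrals of functions of a finite-valued random variable. -/

section FiniteValued

variable {Ω : Type*} [MeasurableSpace Ω] {μ : Measure Ω} [IsFiniteMeasure μ] {T : Type*} [Fintype T]

omit [MeasurableSpace Ω] in
theorem eq_sum_indicator (f : Ω → T) (G : T → ℝ) :
    (fun ω => G (f ω)) = fun ω => ∑ t, Set.indicator {ω | f ω = t} (fun _ => G t) ω := by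
  funext ω
  rw [Finset.sum_eq_single (f ω)]
  · simp
  · intro t _ ht
    exact Set.indicator_of_notMem (fun h => ht (Eq.symm h)) _
  · simp

theorem integrable_comp_of_fintype {f : Ω → T} (hf : ∀ t, MeasurableSet {ω | f ω = t})
    (G : T → ℝ) : Integrable (fun ω => G (f ω)) μ := by
  rw [eq_sum_indicator]
  exact integrable_finsetSum _ fun t _ => (integrable_const _).indicator (hf t)

theorem integral_comp_of_fintype {f : Ω → T} (hf : ∀ t, MeasurableSet {ω | f ω = t})
    (G : T → ℝ) : ∫ ω, G (f ω) ∂μ = ∑ t, μ.real {ω | f ω = t} * G t := by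
  rw [eq_sum_indicator, integral_finsetSum _ fun t _ => (integrable_const _).indicator (hf t)]
  simp only [integral_indicator_const _ (hf _), smul_eq_mul]

end FiniteValued

/-! ### Functions of the history and the Markov property. -/

section Markov

variable {S A : Type*} {Ω : Type*}

/-- The quantity `g` is a function of the states and actions up to time `m`. -/
def DependsUpTo (X : ℕ → Ω → S) (Y : ℕ → Ω → A) (m : ℕ) {β : Type*} (g : Ω → β) : Prop :=
  ∀ ω ω', (∀ i ≤ m, X i ω = X i ω' ∧ Y i ω = Y i ω') → g ω = g ω'

theorem DependsUpTo.mono {X : ℕ → Ω → S} {Y : ℕ → Ω → A} {m m' : ℕ} {β : Type*} {g : Ω → β}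
    (h : DependsUpTo X Y m g) (hm : m ≤ m') : DependsUpTo X Y m' g :=
  fun ω ω' hω => h ω ω' fun i hi => hω i (hi.trans hm)

theorem DependsUpTo.comp {X : ℕ → Ω → S} {Y : ℕ → Ω → A} {m : ℕ} {β β' : Type*} {g : Ω → β}
    (h : DependsUpTo X Y m g) (f : β → β') : DependsUpTo X Y m fun ω => f (g ω) :=
  fun ω ω' hω => congrArg f (h ω ω' hω)

theorem DependsUpTo.map₂ {X : ℕ → Ω → S} {Y : ℕ → Ω → A} {m : ℕ} {β β' β'' : Type*} {g : Ω → β}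
    {g' : Ω → β'} (h : DependsUpTo X Y m g) (h' : DependsUpTo X Y m g') (f : β → β' → β'') :
    DependsUpTo X Y m fun ω => f (g ω) (g' ω) :=
  fun ω ω' hω => congrArg₂ f (h ω ω' hω) (h' ω ω' hω)

theorem dependsUpTo_state (X : ℕ → Ω → S) (Y : ℕ → Ω → A) {i m : ℕ} (hi : i ≤ m) :
    DependsUpTo X Y m (X i) := fun _ _ h => (h i hi).1

theorem dependsUpTo_action (X : ℕ → Ω → S) (Y : ℕ → Ω → A) {i m : ℕ} (hi : i ≤ m) :
    DependsUpTo X Y m (Y i) := fun _ _ h => (h i hi).2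

/-- The states and actions up to time `m`. -/
def history (X : ℕ → Ω → S) (Y : ℕ → Ω → A) (m : ℕ) (ω : Ω) : Fin (m + 1) → S × A :=
  fun i => (X i ω, Y i ω)

/-- Factoring through a finite type reduces integrability and integrals to finite sums, with no
σ-algebra on `S` or `A`. -/
theorem DependsUpTo.exists_history {X : ℕ → Ω → S} {Y : ℕ → Ω → A} {m : ℕ} {β : Type*}
    [Nonempty β] {g : Ω → β} (h : DependsUpTo X Y m g) :
    ∃ G : (Fin (m + 1) → S × A) → β, ∀ ω, g ω = G (history X Y m ω) := by
  have hfac : g.FactorsThrough (history X Y m) := by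
    intro ω ω' hω
    refine h ω ω' fun i hi => ?_
    have := congrFun hω ⟨i, Nat.lt_succ_of_le hi⟩
    exact Prod.ext_iff.1 this
  exact ⟨Function.extend (history X Y m) g fun _ => Classical.arbitrary β,
    fun ω => (hfac.extend_apply _ ω).symm⟩

theorem setOf_history_eq (X : ℕ → Ω → S) (Y : ℕ → Ω → A) (m : ℕ) (t : Fin (m + 1) → S × A) :
    {ω | history X Y m ω = t} = {ω | ∀ i : Fin (m + 1), X i ω = (t i).1 ∧ Y i ω = (t i).2} := by
  ext ω
  simp [history, funext_iff, Prod.ext_iff]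

variable [Fintype S] [Fintype A] [MeasurableSpace Ω] {μ : Measure Ω}
  {M : MDP S A} {π : Policy S A} {X : ℕ → Ω → S} {Y : ℕ → Ω → A}

theorem IsTrajectory.measurableSet_history (h : IsTrajectory μ M π X Y) (m : ℕ)
    (t : Fin (m + 1) → S × A) : MeasurableSet {ω | history X Y m ω = t} := by
  rw [setOf_history_eq, Set.ofPred_forall]
  exact MeasurableSet.iInter fun i =>
    (h.measurableSet_state _ _).inter (h.measurableSet_action _ _)

variable [IsFiniteMeasure μ]

theorem DependsUpTo.integrable (h : IsTrajectory μ M π X Y) {m : ℕ} {g : Ω → ℝ}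
    (hg : DependsUpTo X Y m g) : Integrable g μ := by
  obtain ⟨G, hG⟩ := hg.exists_history
  rw [show g = fun ω => G (history X Y m ω) from funext hG]
  exact integrable_comp_of_fintype (h.measurableSet_history m) G

/-- The Markov property of a trajectory. -/
theorem IsTrajectory.integral_step (h : IsTrajectory μ M π X Y) {m : ℕ} {F : Ω → S → A → ℝ}
    (hF : DependsUpTo X Y m F) :
    ∫ ω, F ω (X (m + 1) ω) (Y (m + 1) ω) ∂μ =
      ∫ ω, ∑ s, M.P (Y m ω) (X m ω) s * ∑ a, π.prob s a * F ω s a ∂μ := by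
  obtain ⟨G, hG⟩ := hF.exists_history
  have hm : ∀ t : (Fin (m + 1) → S × A) × S × A,
      {ω | (history X Y m ω, X (m + 1) ω, Y (m + 1) ω) = t} =
        {ω | (∀ i : Fin (m + 1), X i ω = (t.1 i).1 ∧ Y i ω = (t.1 i).2) ∧
          X (m + 1) ω = t.2.1 ∧ Y (m + 1) ω = t.2.2} := by
    intro t
    have := fun ω => Set.ext_iff.1 (setOf_history_eq X Y m t.1) ω
    ext ω
    simp only [Set.mem_ofPred_eq] at this ⊢
    rw [Prod.ext_iff, Prod.ext_iff, ← this]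
  have hmeas : ∀ t : (Fin (m + 1) → S × A) × S × A,
      MeasurableSet {ω | (history X Y m ω, X (m + 1) ω, Y (m + 1) ω) = t} := by
    intro t
    rw [hm]
    have := h.measurableSet_history m t.1
    rw [setOf_history_eq] at this
    exact this.inter ((h.measurableSet_state _ _).inter (h.measurableSet_action _ _))
  have h1 := integral_comp_of_fintype (μ := μ) hmeas fun t => G t.1 t.2.1 t.2.2
  have h2 := integral_comp_of_fintype (μ := μ) (h.measurableSet_history m) fun t =>
    ∑ s, M.P (t (Fin.last m)).2 (t (Fin.last m)).1 s * ∑ a, π.prob s a * G t s a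
  simp only [hG]
  refine h1.trans (Eq.trans ?_ h2.symm)
  rw [Fintype.sum_prod_type]
  refine Finset.sum_congr rfl fun t _ => ?_
  rw [Fintype.sum_prod_type, Finset.mul_sum]
  refine Finset.sum_congr rfl fun s _ => ?_
  rw [Finset.mul_sum, Finset.mul_sum]
  refine Finset.sum_congr rfl fun a _ => ?_
  rw [hm, setOf_history_eq, h.step]
  ring

variable [DecidableEq S]

/-- The first transition uses the observed action at time `m`; only the following `r` steps are
governed by the state chain of the policy. The induction moves the base time forward and then
averages over the extra step. -/
theorem IsTrajectory.integral_steps (h : IsTrajectory μ M π X Y) (r : ℕ) {m : ℕ}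
    {F : Ω → S → A → ℝ} (hF : DependsUpTo X Y m F) :
    ∫ ω, F ω (X (m + 1 + r) ω) (Y (m + 1 + r) ω) ∂μ =
      ∫ ω, ∑ s, M.P (Y m ω) (X m ω) s *
        ∑ s', (M.trans π ^ r) s s' * ∑ a, π.prob s' a * F ω s' a ∂μ := by
  induction r generalizing m with
  | zero =>
    rw [add_zero, h.integral_step hF]
    simp [Matrix.one_apply]
  | succ r ih =>
    have h1 := ih (hF.mono (Nat.le_succ m))
    rw [show m + 1 + (r + 1) = m.succ + 1 + r by omega, h1,
      h.integral_step (F := fun ω s a => ∑ s₁, M.P a s s₁ *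
        ∑ s', (M.trans π ^ r) s₁ s' * ∑ a', π.prob s' a' * F ω s' a')
        (hF.comp fun f s a => ∑ s₁, M.P a s s₁ * ∑ s', (M.trans π ^ r) s₁ s' *
          ∑ a', π.prob s' a' * f s' a')]
    refine integral_congr_ae (Filter.Eventually.of_forall fun ω => ?_)
    refine Finset.sum_congr rfl fun s _ => ?_
    congr 1
    set W : S → ℝ := fun s' => ∑ a, π.prob s' a * F ω s' a
    have e1 : ∑ s', (M.trans π ^ (r + 1)) s s' * W s' =
        ∑ s₁, M.trans π s s₁ * ∑ s', (M.trans π ^ r) s₁ s' * W s' := by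
      simp only [pow_succ', Matrix.mul_apply, Finset.sum_mul, Finset.mul_sum]
      rw [Finset.sum_comm]
      exact Finset.sum_congr rfl fun _ _ => Finset.sum_congr rfl fun _ _ => mul_assoc _ _ _
    refine Eq.trans ?_ e1.symm
    simp only [MDP.trans, Finset.sum_mul]
    rw [Finset.sum_comm]
    refine Finset.sum_congr rfl fun a _ => ?_
    rw [Finset.mul_sum]
    exact Finset.sum_congr rfl fun s₁ _ => (mul_assoc _ _ _).symm

end Markov

/-! ### Decorrelation of the update from an earlier iterate. -/

section Mixing

variable {S A : Type*} [Fintype S] [Fintype A] {Ω : Type*}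
  {M : MDP S A} {πb π : Policy S A} {cbar ρbar : ℝ} {X : ℕ → Ω → S} {Y : ℕ → Ω → A}

theorem dependsUpTo_correction {V : Ω → S → ℝ} (n : ℕ) {k m : ℕ} (hV : DependsUpTo X Y m V)
    (hm : k + n ≤ m) : DependsUpTo X Y m fun ω =>
      M.correction πb π cbar ρbar (V ω) (fun i => X i ω) (fun i => Y i ω) n k := by
  intro ω ω' h
  simp only [hV ω ω' h, MDP.correction]
  refine Finset.sum_congr rfl fun i hi => ?_
  have hi := Finset.mem_range.1 hi
  have hj : ∀ j ∈ Finset.range i, truncRatio πb π cbar (X (k + j) ω) (Y (k + j) ω) =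
      truncRatio πb π cbar (X (k + j) ω') (Y (k + j) ω') := by
    intro j hj
    have hj := Finset.mem_range.1 hj
    rw [(h (k + j) (by omega)).1, (h (k + j) (by omega)).2]
  rw [Finset.prod_congr rfl hj, (h (k + i) (by omega)).1, (h (k + i) (by omega)).2,
    (h (k + i + 1) (by omega)).1]

/-- The last correction entering V_k starts at time k − 1 and reads up to time k + n − 1. This
look-ahead is why the delay contains `n` besides the mixing time. -/
theorem dependsUpTo_iterate [DecidableEq S] (n : ℕ) (α : ℝ) (V₀ : S → ℝ) {k m : ℕ}
    (hm : k + n ≤ m + 1) :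
    DependsUpTo X Y m fun ω =>
      iterate M πb π n cbar ρbar (fun _ => α) V₀ (fun i => X i ω) (fun i => Y i ω) k := by
  induction k with
  | zero => intro ω ω' _; rfl
  | succ k ih =>
    have h1 := ih (by omega)
    have h2 := dependsUpTo_correction (M := M) (πb := πb) (π := π) (cbar := cbar) (ρbar := ρbar)
      n (k := k) h1 (by omega)
    intro ω ω' h
    simp only [iterate_succ_eq]
    exact (h1.map₂ (h2.map₂ (dependsUpTo_state X Y (by omega : k ≤ m)) Prod.mk)
      fun V p => V + α • Pi.single p.2 p.1) ω ω' h

variable [MeasurableSpace Ω] {μ : Measure Ω} [IsFiniteMeasure μ]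

/-- Induction on `n`, moving `m` forward: the weight γ c of the current step is absorbed into the
prefactor `f`, then the Markov property is applied once. -/
theorem IsTrajectory.integral_mul_correction (h : IsTrajectory μ M πb X Y) (n : ℕ) {m : ℕ}
    {f : Ω → ℝ} {V : Ω → S → ℝ} (hf : DependsUpTo X Y m f) (hV : DependsUpTo X Y m V) :
    ∫ ω, f ω * M.correction πb π cbar ρbar (V ω) (fun i => X i ω) (fun i => Y i ω) n m ∂μ =
      ∫ ω, f ω * M.condMean πb π cbar ρbar (V ω) n (X m ω) (Y m ω) ∂μ := by
  induction n generalizing m f with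
  | zero => simp [MDP.correction, MDP.condMean]
  | succ n ih =>
    have hX := dependsUpTo_state X Y (le_refl m)
    have hY := dependsUpTo_action X Y (le_refl m)
    set r : Ω → ℝ := fun ω => truncRatio πb π ρbar (X m ω) (Y m ω)
    set c : Ω → ℝ := fun ω => truncRatio πb π cbar (X m ω) (Y m ω)
    have hr : DependsUpTo X Y m r := hX.map₂ hY _
    have hc : DependsUpTo X Y m c := hX.map₂ hY _
    have hg : DependsUpTo X Y m fun ω => f ω * (M.γ * c ω) :=
      hf.map₂ hc fun f c => f * (M.γ * c)
    have htd : DependsUpTo X Y m fun ω s => M.tempDiff (V ω) (X m ω) (Y m ω) s :=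
      hV.map₂ (hX.map₂ hY Prod.mk) fun V p => M.tempDiff V p.1 p.2
    have hcm : DependsUpTo X Y m fun ω => M.condMean πb π cbar ρbar (V ω) n :=
      hV.comp fun V => M.condMean πb π cbar ρbar V n
    have i1 : Integrable (fun ω =>
        f ω * (r ω * M.tempDiff (V ω) (X m ω) (Y m ω) (X (m + 1) ω))) μ := by
      have h1 : DependsUpTo X Y (m + 1) fun ω => M.tempDiff (V ω) (X m ω) (Y m ω) (X (m + 1) ω) :=
        (htd.mono (Nat.le_succ m)).map₂ (dependsUpTo_state X Y (le_refl (m + 1)))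
          fun t x => t x
      exact DependsUpTo.integrable h ((hf.mono (Nat.le_succ m)).map₂
        ((hr.mono (Nat.le_succ m)).map₂ h1 fun a b => a * b) fun a b => a * b)
    have i2 : Integrable (fun ω => f ω * (M.γ * c ω) *
        M.correction πb π cbar ρbar (V ω) (fun i => X i ω) (fun i => Y i ω) n (m + 1)) μ :=
      DependsUpTo.integrable h ((hg.mono (by omega : m ≤ m + 1 + n)).map₂
        (dependsUpTo_correction n (hV.mono (by omega)) le_rfl) fun a b => a * b)
    have i3 : Integrable (fun ω => f ω * (M.γ * c ω) *
        M.condMean πb π cbar ρbar (V ω) n (X (m + 1) ω) (Y (m + 1) ω)) μ :=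
      DependsUpTo.integrable h ((hg.mono (Nat.le_succ m)).map₂
        ((hcm.mono (Nat.le_succ m)).map₂ ((dependsUpTo_state X Y (le_refl (m + 1))).map₂
          (dependsUpTo_action X Y (le_refl (m + 1))) Prod.mk) fun g p => g p.1 p.2)
            fun a b => a * b)
    have e1 : ∀ ω, f ω * M.correction πb π cbar ρbar (V ω) (fun i => X i ω) (fun i => Y i ω)
        (n + 1) m = f ω * (r ω * M.tempDiff (V ω) (X m ω) (Y m ω) (X (m + 1) ω)) +
          f ω * (M.γ * c ω) * M.correction πb π cbar ρbar (V ω) (fun i => X i ω)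
            (fun i => Y i ω) n (m + 1) := by
      intro ω
      rw [MDP.correction_succ]
      ring
    simp only [e1]
    rw [integral_add i1 i2, ih (hg.mono (Nat.le_succ m)) (hV.mono (Nat.le_succ m)),
      ← integral_add i1 i3]
    have hF : DependsUpTo X Y m fun ω s a =>
        f ω * (r ω * M.tempDiff (V ω) (X m ω) (Y m ω) s) +
          f ω * (M.γ * c ω) * M.condMean πb π cbar ρbar (V ω) n s a :=
      (hf.map₂ hr Prod.mk).map₂ (htd.map₂ (hg.map₂ hcm Prod.mk) Prod.mk)
        fun p q s a => p.1 * (p.2 * q.1 s) + q.2.1 * q.2.2 s a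
    refine (h.integral_step hF).trans ?_
    refine integral_congr_ae (Filter.Eventually.of_forall fun ω => ?_)
    simp only [MDP.condMean, Finset.mul_sum]
    refine Finset.sum_congr rfl fun s _ => Finset.sum_congr rfl fun a _ => ?_
    ring

variable [DecidableEq S]

/-- The stationary mean of the linear part of an update. -/
noncomputable def MDP.drift (M : MDP S A) (πb π : Policy S A) (n : ℕ) (cbar : ℝ) (κ : S → ℝ) :
    (S → ℝ) →ₗ[ℝ] (S → ℝ) :=
  (Matrix.diagonal κ).mulVecLin ∘ₗ M.meanUpdate πb π cbar n

theorem MDP.drift_apply (M : MDP S A) (πb π : Policy S A) (n : ℕ) (cbar : ℝ) (κ v : S → ℝ) (s : S) :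
    M.drift πb π n cbar κ v s = κ s * M.meanUpdate πb π cbar n v s := by
  simp [MDP.drift, Matrix.mulVec_diagonal]

omit [Fintype S] in
theorem linearMap_apply_single (ℓ : (S → ℝ) →ₗ[ℝ] ℝ) (s : S) (c : ℝ) :
    ℓ (Pi.single s c) = c * ℓ (Pi.single s 1) := by
  rw [← smul_eq_mul, ← map_smul, ← Pi.single_smul, smul_eq_mul, mul_one]

theorem linearMap_apply_eq_sum (ℓ : (S → ℝ) →ₗ[ℝ] ℝ) (v : S → ℝ) :
    ℓ v = ∑ s, v s * ℓ (Pi.single s 1) := by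
  conv_lhs => rw [← Finset.univ_sum_single v]
  rw [map_sum]
  exact Finset.sum_congr rfl fun s _ => linearMap_apply_single ℓ s _

/-- After the mixing time, the update is nearly uncorrelated with the past. -/
theorem IsTrajectory.abs_integral_mul_update_sub_le [Nonempty S] (h : IsTrajectory μ M πb X Y)
    (hπb : ∀ s a, 0 < πb.prob s a) (hc : 0 ≤ cbar) (hρ : ∀ s a, π.prob s a / πb.prob s a ≤ ρbar)
    {κ : S → ℝ} {τ : ℕ} {δ : ℝ} (hτ : ∀ s s', |(M.trans πb ^ τ) s s' - κ s'| ≤ 2 * δ)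
    (n : ℕ) {m : ℕ} {f : Ω → ℝ} {V : Ω → S → ℝ} (hf : DependsUpTo X Y m f)
    (hV : DependsUpTo X Y m V) (ℓ : (S → ℝ) →ₗ[ℝ] ℝ) {lam : ℝ} (hℓ : ∀ v, |ℓ v| ≤ lam * ‖v‖)
    (hlam : 0 ≤ lam) :
    |∫ ω, f ω * ℓ (Pi.single (X (m + 1 + τ) ω) (M.correction πb π cbar ρbar (V ω)
        (fun i => X i ω) (fun i => Y i ω) n (m + 1 + τ)) -
          M.drift πb π n cbar κ (V ω - M.value π)) ∂μ| ≤
      ∫ ω, 4 * δ * lam * (|f ω| * ‖V ω - M.value π‖) ∂μ := by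
  set j := m + 1 + τ
  have hmj : m ≤ j := by omega
  set U : Ω → ℝ := fun ω => M.correction πb π cbar ρbar (V ω) (fun i => X i ω) (fun i => Y i ω) n j
  have hXm := dependsUpTo_state X Y (le_refl m)
  have hYm := dependsUpTo_action X Y (le_refl m)
  have hU : DependsUpTo X Y (j + n) U := dependsUpTo_correction n (hV.mono (by omega)) le_rfl
  have hdr : DependsUpTo X Y m fun ω => f ω * ℓ (M.drift πb π n cbar κ (V ω - M.value π)) :=
    hf.map₂ hV fun f V => f * ℓ (M.drift πb π n cbar κ (V - M.value π))
  have hfs : DependsUpTo X Y j fun ω => f ω * ℓ (Pi.single (X j ω) 1) :=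
    (hf.mono hmj).map₂ (dependsUpTo_state X Y (le_refl j)) fun f x => f * ℓ (Pi.single x 1)
  have i1 : Integrable (fun ω => f ω * ℓ (Pi.single (X j ω) 1) * U ω) μ :=
    DependsUpTo.integrable h ((hfs.mono (by omega)).map₂ hU fun a b => a * b)
  have i2 := DependsUpTo.integrable h hdr
  -- The law of X_j given the history up to `m`: an average of rows of the `τ`-th power, hence still
  -- within 2δ of `κ` entrywise.
  set p : Ω → S → ℝ := fun ω s' => ∑ s, M.P (Y m ω) (X m ω) s * (M.trans πb ^ τ) s s'
  have hp : DependsUpTo X Y m p := hXm.map₂ hYm fun x y s' =>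
    ∑ s, M.P y x s * (M.trans πb ^ τ) s s'
  have e1 : ∫ ω, f ω * ℓ (Pi.single (X j ω) 1) * U ω ∂μ =
      ∫ ω, f ω * ℓ (fun s' => p ω s' * M.meanUpdate πb π cbar n (V ω - M.value π) s') ∂μ := by
    rw [h.integral_mul_correction n hfs (hV.mono hmj)]
    have hF : DependsUpTo X Y m fun ω s a =>
        f ω * ℓ (Pi.single s 1) * M.condMean πb π cbar ρbar (V ω) n s a :=
      hf.map₂ hV fun f V s a => f * ℓ (Pi.single s 1) * M.condMean πb π cbar ρbar V n s a
    refine (h.integral_steps τ hF).trans ?_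
    refine integral_congr_ae (Filter.Eventually.of_forall fun ω => ?_)
    have e2 : ∀ s', ∑ a, πb.prob s' a *
        (f ω * ℓ (Pi.single s' 1) * M.condMean πb π cbar ρbar (V ω) n s' a) =
        f ω * ℓ (Pi.single s' 1) * M.meanUpdate πb π cbar n (V ω - M.value π) s' := by
      intro s'
      rw [← M.sum_prob_mul_condMean π hπb hρ, Finset.mul_sum]
      exact Finset.sum_congr rfl fun a _ => by ring
    simp only [e2]
    rw [linearMap_apply_eq_sum ℓ]
    simp only [p, Finset.mul_sum, Finset.sum_mul]
    rw [Finset.sum_comm]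
    refine Finset.sum_congr rfl fun s _ => Finset.sum_congr rfl fun s' _ => ?_
    ring
  have i3 : Integrable (fun ω =>
      f ω * ℓ (fun s' => p ω s' * M.meanUpdate πb π cbar n (V ω - M.value π) s')) μ :=
    DependsUpTo.integrable h (hf.map₂ (hp.map₂ hV fun p V s' =>
      p s' * M.meanUpdate πb π cbar n (V - M.value π) s') fun f v => f * ℓ v)
  have e3 : ∀ ω, f ω * ℓ (Pi.single (X j ω) (M.correction πb π cbar ρbar (V ω)
      (fun i => X i ω) (fun i => Y i ω) n j) - M.drift πb π n cbar κ (V ω - M.value π)) =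
      f ω * ℓ (Pi.single (X j ω) 1) * U ω -
        f ω * ℓ (M.drift πb π n cbar κ (V ω - M.value π)) := by
    intro ω
    rw [map_sub, linearMap_apply_single]
    ring
  simp only [e3]
  rw [integral_sub i1 i2, e1, ← integral_sub i3 i2]
  have i4 : Integrable (fun ω => 4 * δ * lam * (|f ω| * ‖V ω - M.value π‖)) μ :=
    DependsUpTo.integrable h (hf.map₂ hV fun f V => 4 * δ * lam * (|f| * ‖V - M.value π‖))
  rw [← Real.norm_eq_abs]
  refine norm_integral_le_of_norm_le i4 (Filter.Eventually.of_forall fun ω => ?_)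
  rw [← mul_sub, ← map_sub, Real.norm_eq_abs, abs_mul]
  have hδ : 0 ≤ 2 * δ := (abs_nonneg _).trans
    (hτ (Classical.arbitrary S) (Classical.arbitrary S))
  have hpκ : ∀ s', |p ω s' - κ s'| ≤ 2 * δ := by
    intro s'
    have := abs_sum_mul_le (M.P_nonneg (Y m ω) (X m ω)) fun s => hτ s s'
    simp only [mul_sub, Finset.sum_sub_distrib, ← Finset.sum_mul, M.P_sum, one_mul] at this
    exact this
  have hn : ‖(fun s' => p ω s' * M.meanUpdate πb π cbar n (V ω - M.value π) s') -
      M.drift πb π n cbar κ (V ω - M.value π)‖ ≤ 2 * δ * (2 * ‖V ω - M.value π‖) := by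
    rw [pi_norm_le_iff_of_nonneg (by positivity)]
    intro s'
    rw [Pi.sub_apply, M.drift_apply, ← sub_mul, Real.norm_eq_abs, abs_mul]
    exact mul_le_mul (hpκ s') ((abs_apply_le_norm _ s').trans (M.norm_meanUpdate_le π hπb hc n _))
      (abs_nonneg _) hδ
  calc _ ≤ |f ω| * (lam * (2 * δ * (2 * ‖V ω - M.value π‖))) := by
        gcongr
        exact (hℓ _).trans (mul_le_mul_of_nonneg_left hn hlam)
    _ = _ := by ring

end Mixing

/-! ### Linear stochastic approximation through linear functionals. -/

section StochasticApproximation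

/-- Since `β * t ≤ 1 / 4`, the quantity ‖v‖ + b at most doubles along the window, so each increment
is at most 2β times its initial value. -/
theorem norm_sub_le_of_increments {E : Type*} [NormedAddCommGroup E] {v : ℕ → E} {β b : ℝ} {t : ℕ}
    (hβ : 0 ≤ β) (hβt : β * t ≤ 1 / 4) (hv : ∀ k, ‖v (k + 1) - v k‖ ≤ β * (‖v k‖ + b))
    (hb : 0 ≤ b) (i : ℕ) {r : ℕ} (hr : r ≤ t) :
    ‖v (i + r) - v i‖ ≤ 2 * β * r * (‖v i‖ + b) := by
  induction r with
  | zero => simp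
  | succ r ih =>
    have ih := ih (by omega)
    have h1 := norm_sub_le_norm_sub_add_norm_sub (v (i + (r + 1))) (v (i + r)) (v i)
    have h2 := hv (i + r)
    have h3 : ‖v (i + r)‖ ≤ ‖v i‖ + ‖v (i + r) - v i‖ := by
      have := norm_add_le (v i) (v (i + r) - v i)
      rwa [add_sub_cancel] at this
    have h4 : β * r ≤ 1 / 4 := by
      refine le_trans (mul_le_mul_of_nonneg_left ?_ hβ) hβt
      exact_mod_cast (by omega : r ≤ t)
    have hy : 0 ≤ ‖v i‖ + b := by positivity
    have h5 := mul_le_mul_of_nonneg_right h4 hy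
    have h6 : β * (‖v (i + r)‖ + b) ≤ β * (2 * (‖v i‖ + b)) :=
      mul_le_mul_of_nonneg_left (by nlinarith) hβ
    rw [← add_assoc] at h1 ⊢
    push_cast
    nlinarith

/-- One step of linear stochastic approximation, seen through a linear functional `ℓ` and compared
with the increment `u'` at an earlier point `w'`. -/
theorem sq_apply_step_le {E : Type*} [NormedAddCommGroup E] [NormedSpace ℝ E] (Abar : E →ₗ[ℝ] E)
    (ℓ : E →ₗ[ℝ] ℝ) {α g b t lam : ℝ} (hα : 0 ≤ α) (hg : 2 ≤ g) (hb : 0 ≤ b) (ht : 1 ≤ t)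
    (hlam : 0 ≤ lam) (hαgt : α * g * t ≤ 1 / 4) (hA : ∀ v, ‖Abar v‖ ≤ 2 * ‖v‖)
    (hB : ∀ v, ‖v + α • Abar v‖ ≤ ‖v‖) (hℓ : ∀ v, |ℓ v| ≤ lam * ‖v‖) {w w' u u' : E}
    (hw : ‖w - w'‖ ≤ 2 * (α * g) * t * (‖w'‖ + b)) (hu : ‖u‖ ≤ g * (‖w‖ + b))
    (huu' : ‖u - u'‖ ≤ g * ‖w - w'‖) :
    ℓ (w + α • u) ^ 2 ≤ ℓ (w + α • Abar w) ^ 2 +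
      2 * α * (ℓ (w' + α • Abar w') * ℓ (u' - Abar w')) +
        52 * lam ^ 2 * α ^ 2 * g ^ 2 * t * (‖w‖ + b) ^ 2 ∧ ‖w'‖ ≤ 2 * (‖w‖ + b) := by
  set y := ‖w‖ + b
  set y' := ‖w'‖ + b
  have hn := norm_nonneg w
  have hn' := norm_nonneg w'
  have hy : 0 ≤ y := by positivity
  have hy' : 0 ≤ y' := by positivity
  have h1 : ‖w'‖ ≤ ‖w‖ + ‖w - w'‖ := by
    have := norm_sub_le w (w - w')
    rwa [sub_sub_cancel] at this
  have h2 : y' ≤ 2 * y := by nlinarith [mul_le_mul_of_nonneg_right hαgt hy']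
  have hD : ‖w - w'‖ ≤ 4 * (α * g * t) * y := by
    refine hw.trans ?_
    have : 0 ≤ α * g * t := by positivity
    nlinarith
  have hξ : ‖u - Abar w‖ ≤ 2 * g * y := by
    have := norm_sub_le u (Abar w)
    have := hA w
    nlinarith
  have hξξ : ‖(u - Abar w) - (u' - Abar w')‖ ≤ 2 * g * ‖w - w'‖ := by
    have e : (u - Abar w) - (u' - Abar w') = (u - u') - Abar (w - w') := by
      rw [map_sub]; abel
    rw [e]
    have := norm_sub_le (u - u') (Abar (w - w'))
    have := hA (w - w')
    nlinarith [norm_nonneg (w - w')]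
  refine ⟨?_, by linarith⟩
  set B : E → E := fun v => v + α • Abar v
  have hBsub : B w - B w' = B (w - w') := by
    simp only [B, map_sub, smul_sub]; abel
  have e1 : ℓ (w + α • u) = ℓ (B w) + α * ℓ (u - Abar w) := by
    simp only [B, map_add, map_sub, map_smul, smul_eq_mul]; ring
  have p1 : |ℓ (B w) - ℓ (B w')| ≤ lam * ‖w - w'‖ := by
    rw [← map_sub, hBsub]
    exact (hℓ _).trans (mul_le_mul_of_nonneg_left (hB _) hlam)
  have p2 : |ℓ (B w')| ≤ lam * (2 * y) :=
    (hℓ _).trans (mul_le_mul_of_nonneg_left ((hB _).trans (by linarith)) hlam)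
  have p3 : |ℓ (u - Abar w)| ≤ lam * (2 * g * y) :=
    (hℓ _).trans (mul_le_mul_of_nonneg_left hξ hlam)
  have p4 : |ℓ (u - Abar w) - ℓ (u' - Abar w')| ≤ lam * (2 * g * ‖w - w'‖) := by
    rw [← map_sub]
    exact (hℓ _).trans (mul_le_mul_of_nonneg_left hξξ hlam)
  -- Freezing both factors of the cross term at the earlier point costs (2 + 4) · 4 = 24; doubled,
  -- together with the 4 of the squared noise in `c2`, this gives the 52 of the statement.
  have c1 : ℓ (B w) * ℓ (u - Abar w) - ℓ (B w') * ℓ (u' - Abar w') ≤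
      24 * lam ^ 2 * (α * g ^ 2 * t) * y ^ 2 := by
    calc _ = (ℓ (B w) - ℓ (B w')) * ℓ (u - Abar w) +
          ℓ (B w') * (ℓ (u - Abar w) - ℓ (u' - Abar w')) := by ring
      _ ≤ |ℓ (B w) - ℓ (B w')| * |ℓ (u - Abar w)| +
          |ℓ (B w')| * |ℓ (u - Abar w) - ℓ (u' - Abar w')| := by
          rw [← abs_mul, ← abs_mul]
          exact add_le_add (le_abs_self _) (le_abs_self _)
      _ ≤ lam * ‖w - w'‖ * (lam * (2 * g * y)) + lam * (2 * y) * (lam * (2 * g * ‖w - w'‖)) := by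
          gcongr
      _ = 6 * lam ^ 2 * g * y * ‖w - w'‖ := by ring
      _ ≤ 6 * lam ^ 2 * g * y * (4 * (α * g * t) * y) := by gcongr
      _ = _ := by ring
  have c2 : (α * ℓ (u - Abar w)) ^ 2 ≤ 4 * lam ^ 2 * α ^ 2 * g ^ 2 * t * y ^ 2 := by
    have : ℓ (u - Abar w) ^ 2 ≤ (lam * (2 * g * y)) ^ 2 := by
      rw [← sq_abs]
      exact pow_le_pow_left₀ (abs_nonneg _) p3 2
    rw [mul_pow]
    calc _ ≤ α ^ 2 * (lam * (2 * g * y)) ^ 2 := by gcongr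
      _ = 4 * lam ^ 2 * α ^ 2 * g ^ 2 * y ^ 2 * 1 := by ring
      _ ≤ 4 * lam ^ 2 * α ^ 2 * g ^ 2 * y ^ 2 * t := by gcongr
      _ = _ := by ring
  rw [e1]
  have c3 := mul_le_mul_of_nonneg_left c1 (by positivity : 0 ≤ 2 * α)
  nlinarith

variable {S : Type*} [Fintype S] {Ω : Type*} [MeasurableSpace Ω] {μ : Measure Ω}

theorem sq_norm_le_sum_sq (v : S → ℝ) : ‖v‖ ^ 2 ≤ ∑ s, v s ^ 2 := by
  have h0 : 0 ≤ ∑ s, v s ^ 2 := Finset.sum_nonneg fun s _ => sq_nonneg _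
  rw [← Real.le_sqrt (norm_nonneg _) h0, pi_norm_le_iff_of_nonneg (Real.sqrt_nonneg _)]
  intro s
  rw [Real.norm_eq_abs]
  exact Real.abs_le_sqrt (Finset.single_le_sum (f := fun s => v s ^ 2)
    (fun s _ => sq_nonneg _) (Finset.mem_univ s))

/-- Mean square bound for linear stochastic approximation with constant step size `α`, driven by
noise that is nearly uncorrelated with the iterates `t` steps before, when the mean dynamics
contracts the supremum norm. -/
theorem integral_sq_norm_le [IsProbabilityMeasure μ] {x : ℕ → Ω → S → ℝ}
    {U : ℕ → Ω → (S → ℝ) → (S → ℝ)} {Abar : (S → ℝ) →ₗ[ℝ] (S → ℝ)} {α g b w R : ℝ} {t : ℕ}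
    (hα : 0 < α) (hg : 2 ≤ g) (hb : 0 ≤ b) (ht : 1 ≤ t) (hw : 0 < w) (hαw : α * w ≤ 1)
    (hαgt : α * g * t ≤ 1 / 4)
    (hstep : α * (168 * g ^ 2 * t) * Fintype.card S ≤ w / 2)
    (hA : ∀ v, ‖Abar v‖ ≤ 2 * ‖v‖)
    (hB : ∀ v, ‖v + α • Abar v‖ ≤ (1 - α * w) * ‖v‖)
    (hx : ∀ j ω, x (j + 1) ω = x j ω + α • U j ω (x j ω))
    (hx0 : ∀ ω, ‖x 0 ω‖ ≤ R)
    (hU : ∀ j ω v, ‖U j ω v‖ ≤ g * (‖v‖ + b))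
    (hUU : ∀ j ω v v', ‖U j ω v - U j ω v'‖ ≤ g * ‖v - v'‖)
    (hint : ∀ j (φ : (S → ℝ) → ℝ), Integrable (fun ω => φ (x j ω)) μ)
    (hint' : ∀ i (φ : (S → ℝ) → (S → ℝ) → ℝ),
      Integrable (fun ω => φ (x i ω) (U (i + t) ω (x i ω))) μ)
    (hmix : ∀ i (ℓ : (S → ℝ) →ₗ[ℝ] ℝ) (lam : ℝ), 0 ≤ lam → (∀ v, |ℓ v| ≤ lam * ‖v‖) →
      |∫ ω, ℓ (x i ω + α • Abar (x i ω)) * ℓ (U (i + t) ω (x i ω) - Abar (x i ω)) ∂μ| ≤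
        ∫ ω, 4 * α * lam * (|ℓ (x i ω + α • Abar (x i ω))| * ‖x i ω‖) ∂μ) (k : ℕ) :
    ∫ ω, ‖x (t + k) ω‖ ^ 2 ∂μ ≤ Fintype.card S * ((1 - α * w / 2) ^ k * (2 * (R + b)) ^ 2 +
      2 * α * (168 * g ^ 2 * t) * b ^ 2 / w) := by
  have ht' : (1 : ℝ) ≤ t := by exact_mod_cast ht
  have hB1 : ∀ v, ‖v + α • Abar v‖ ≤ ‖v‖ := fun v =>
    (hB v).trans (mul_le_of_le_one_left (norm_nonneg v) (by nlinarith [mul_pos hα hw]))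
  have hinc : ∀ i ω, ‖x (i + t) ω - x i ω‖ ≤ 2 * (α * g) * t * (‖x i ω‖ + b) := by
    intro i ω
    refine norm_sub_le_of_increments (v := fun i => x i ω) (by positivity) hαgt (fun k => ?_) hb i
      le_rfl
    rw [hx, add_sub_cancel_left, norm_smul, Real.norm_of_nonneg hα.le, mul_assoc]
    exact mul_le_mul_of_nonneg_left (hU k ω _) hα.le
  -- 168 = 2 · (52 + 32): 52 from the one-step bound, 32 from the mixing error, and 2 from (‖x‖ +
  -- b)² ≤ 2(‖x‖² + b²).
  set G := 168 * g ^ 2 * t with hG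
  have hG0 : 0 < G := by positivity
  have one_step : ∀ i (ℓ : (S → ℝ) →ₗ[ℝ] ℝ) (lam : ℝ), 0 ≤ lam → (∀ v, |ℓ v| ≤ lam * ‖v‖) →
      ∫ ω, ℓ (x (i + t + 1) ω) ^ 2 ∂μ ≤ ∫ ω, ℓ (x (i + t) ω + α • Abar (x (i + t) ω)) ^ 2 ∂μ +
        lam ^ 2 * α ^ 2 * G * (∫ ω, ‖x (i + t) ω‖ ^ 2 ∂μ + b ^ 2) := by
    intro i ℓ lam hlam hℓ
    have hdet : ∀ ω, _ := fun ω => sq_apply_step_le Abar ℓ hα.le hg hb ht' hlam hαgt hA hB1 hℓ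
      (hinc i ω) (hU (i + t) ω _) (hUU (i + t) ω _ (x i ω))
    have j1 := hint (i + t + 1) fun v => ℓ v ^ 2
    have j2 := hint (i + t) fun v => ℓ (v + α • Abar v) ^ 2
    have j3 := hint' i fun v u => ℓ (v + α • Abar v) * ℓ (u - Abar v)
    have j4 := hint (i + t) fun v => (‖v‖ + b) ^ 2
    have j5 := hint (i + t) fun v => ‖v‖ ^ 2
    have j6 := hint i fun v => 4 * α * lam * (|ℓ (v + α • Abar v)| * ‖v‖)
    have j7 : Integrable (fun ω => ℓ (x (i + t) ω + α • Abar (x (i + t) ω)) ^ 2 +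
        2 * α * (ℓ (x i ω + α • Abar (x i ω)) * ℓ (U (i + t) ω (x i ω) - Abar (x i ω)))) μ :=
      j2.add (j3.const_mul (2 * α))
    have s1 : ∫ ω, ℓ (x (i + t + 1) ω) ^ 2 ∂μ ≤
        ∫ ω, ℓ (x (i + t) ω + α • Abar (x (i + t) ω)) ^ 2 ∂μ +
          2 * α * ∫ ω, ℓ (x i ω + α • Abar (x i ω)) * ℓ (U (i + t) ω (x i ω) - Abar (x i ω)) ∂μ +
          52 * lam ^ 2 * α ^ 2 * g ^ 2 * t * ∫ ω, (‖x (i + t) ω‖ + b) ^ 2 ∂μ := by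
      rw [← integral_const_mul, ← integral_const_mul, ← integral_add j2 (j3.const_mul _),
        ← integral_add j7 (j4.const_mul _)]
      refine integral_mono j1 (j7.add (j4.const_mul _)) fun ω => ?_
      simp only [hx (i + t) ω]
      exact (hdet ω).1
    have s2 : ∫ ω, 4 * α * lam * (|ℓ (x i ω + α • Abar (x i ω))| * ‖x i ω‖) ∂μ ≤
        16 * α * lam ^ 2 * ∫ ω, (‖x (i + t) ω‖ + b) ^ 2 ∂μ := by
      rw [← integral_const_mul]
      refine integral_mono j6 (j4.const_mul _) fun ω => ?_
      have h1 := (hdet ω).2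
      have h2 : |ℓ (x i ω + α • Abar (x i ω))| ≤ lam * ‖x i ω‖ :=
        (hℓ _).trans (mul_le_mul_of_nonneg_left (hB1 _) hlam)
      calc 4 * α * lam * (|ℓ (x i ω + α • Abar (x i ω))| * ‖x i ω‖)
          ≤ 4 * α * lam * (lam * ‖x i ω‖ * ‖x i ω‖) := by gcongr
        _ = 4 * α * lam ^ 2 * ‖x i ω‖ ^ 2 := by ring
        _ ≤ 4 * α * lam ^ 2 * (2 * (‖x (i + t) ω‖ + b)) ^ 2 := by gcongr
        _ = _ := by ring
    have s3 : ∫ ω, (‖x (i + t) ω‖ + b) ^ 2 ∂μ ≤ 2 * (∫ ω, ‖x (i + t) ω‖ ^ 2 ∂μ + b ^ 2) := by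
      have : ∫ ω, (‖x (i + t) ω‖ + b) ^ 2 ∂μ ≤ ∫ ω, 2 * (‖x (i + t) ω‖ ^ 2 + b ^ 2) ∂μ := by
        refine integral_mono j4 ((j5.add (integrable_const _)).const_mul _) fun ω => ?_
        nlinarith [sq_nonneg (‖x (i + t) ω‖ - b)]
      rw [integral_const_mul, integral_add j5 (integrable_const _)] at this
      simpa using this
    have s4 := (le_abs_self _).trans ((hmix i ℓ lam hlam hℓ).trans s2)
    set Y := ∫ ω, (‖x (i + t) ω‖ + b) ^ 2 ∂μ
    have hY : 0 ≤ Y := integral_nonneg fun ω => sq_nonneg _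
    have s5 := mul_le_mul_of_nonneg_left s4 (by positivity : 0 ≤ 2 * α)
    have hgt : 1 ≤ g ^ 2 * t := by nlinarith
    have s6 : 32 * lam ^ 2 * α ^ 2 * Y ≤ 32 * lam ^ 2 * α ^ 2 * Y * (g ^ 2 * t) :=
      le_mul_of_one_le_right (by positivity) hgt
    have s7 := mul_le_mul_of_nonneg_left s3
      (by positivity : 0 ≤ 84 * lam ^ 2 * α ^ 2 * (g ^ 2 * t))
    rw [hG]
    linarith
  -- The solution of a_{k+1} = (1 − αw/2) a_k + α² G b². Half of the contraction rate is sacrificed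
  -- to absorb the noise proportional to |S| a_k.
  set a : ℕ → ℝ := fun k => (1 - α * w / 2) ^ k * (2 * (R + b)) ^ 2 + 2 * α * G * b ^ 2 / w with ha
  have hαw0 := mul_pos hα hw
  have ha0 : ∀ k, 0 ≤ a k := fun k => by
    have : 0 ≤ 1 - α * w / 2 := by linarith
    positivity
  have hnorm : ∀ j (c : ℝ), (∀ (ℓ : (S → ℝ) →ₗ[ℝ] ℝ) (lam : ℝ), 0 ≤ lam →
      (∀ v, |ℓ v| ≤ lam * ‖v‖) → ∫ ω, ℓ (x j ω) ^ 2 ∂μ ≤ lam ^ 2 * c) →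
      ∫ ω, ‖x j ω‖ ^ 2 ∂μ ≤ Fintype.card S * c := by
    intro j c hc
    calc ∫ ω, ‖x j ω‖ ^ 2 ∂μ ≤ ∫ ω, ∑ s, x j ω s ^ 2 ∂μ :=
          integral_mono (hint j fun v => ‖v‖ ^ 2) (hint j fun v => ∑ s, v s ^ 2)
            fun ω => sq_norm_le_sum_sq _
      _ = ∑ s, ∫ ω, x j ω s ^ 2 ∂μ :=
          integral_finsetSum _ fun s _ => hint j fun v => v s ^ 2
      _ ≤ ∑ _s : S, c := Finset.sum_le_sum fun s _ => by
          have := hc (LinearMap.proj s) 1 zero_le_one fun v => by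
            simpa using abs_apply_le_norm v s
          simpa using this
      _ = _ := by simp
  have main : ∀ k (ℓ : (S → ℝ) →ₗ[ℝ] ℝ) (lam : ℝ), 0 ≤ lam → (∀ v, |ℓ v| ≤ lam * ‖v‖) →
      ∫ ω, ℓ (x (t + k) ω) ^ 2 ∂μ ≤ lam ^ 2 * a k := by
    intro k
    induction k with
    | zero =>
      intro ℓ lam hlam hℓ
      have hc : 0 ≤ 2 * α * G * b ^ 2 / w := by positivity
      have hpt : ∀ ω, ℓ (x (t + 0) ω) ^ 2 ≤ lam ^ 2 * a 0 := by
        intro ω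
        have h1 := hinc 0 ω
        rw [zero_add] at h1
        have h2 : ‖x t ω‖ ≤ ‖x 0 ω‖ + ‖x t ω - x 0 ω‖ := by
          have := norm_add_le (x 0 ω) (x t ω - x 0 ω)
          rwa [add_sub_cancel] at this
        have h3 := hx0 ω
        have h5 : 0 ≤ ‖x 0 ω‖ + b := by positivity
        have h6 := mul_le_mul_of_nonneg_right hαgt h5
        have h4 : ‖x t ω‖ ≤ 2 * (R + b) := by nlinarith [norm_nonneg (x 0 ω)]
        have h7 : |ℓ (x t ω)| ≤ lam * (2 * (R + b)) :=
          (hℓ _).trans (mul_le_mul_of_nonneg_left h4 hlam)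
        calc ℓ (x (t + 0) ω) ^ 2 = |ℓ (x t ω)| ^ 2 := by rw [sq_abs, add_zero]
          _ ≤ (lam * (2 * (R + b))) ^ 2 := pow_le_pow_left₀ (abs_nonneg _) h7 2
          _ = lam ^ 2 * (2 * (R + b)) ^ 2 := by ring
          _ ≤ _ := by
            refine mul_le_mul_of_nonneg_left ?_ (sq_nonneg _)
            simp only [ha, pow_zero, one_mul]
            linarith
      refine (integral_mono (hint _ fun v => ℓ v ^ 2) (integrable_const _) hpt).trans ?_
      simp
    | succ k ih =>
      intro ℓ lam hlam hℓ
      have h1 := one_step k ℓ lam hlam hℓ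
      rw [add_comm k t] at h1
      have hq : 0 ≤ 1 - α * w := by linarith
      -- Quantifying over all functionals pays off here: the mean step is moved from the iterate to
      -- `ℓ`, whose norm bound shrinks by 1 − αw.
      have h2 := ih (ℓ ∘ₗ (LinearMap.id + α • Abar)) (lam * (1 - α * w)) (by positivity)
        fun v => (hℓ _).trans (by
          rw [mul_assoc]
          exact mul_le_mul_of_nonneg_left (hB v) hlam)
      have h3 := hnorm (t + k) (a k) ih
      have h2' : ∫ ω, ℓ (x (t + k) ω + α • Abar (x (t + k) ω)) ^ 2 ∂μ ≤
          (lam * (1 - α * w)) ^ 2 * a k := h2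
      rw [add_assoc] at h1
      refine h1.trans ((add_le_add h2' (mul_le_mul_of_nonneg_left (add_le_add_left h3 _)
        (by positivity))).trans ?_)
      have h4 : a (k + 1) = (1 - α * w / 2) * a k + α ^ 2 * G * b ^ 2 := by
        simp only [ha]
        field_simp
        ring
      rw [h4]
      have h5 : (1 - α * w) ^ 2 ≤ 1 - α * w := by nlinarith
      have h6 := mul_le_mul_of_nonneg_right h5 (ha0 k)
      have h7 := mul_le_mul_of_nonneg_right (mul_le_mul_of_nonneg_left hstep hα.le) (ha0 k)
      have h8 : (1 - α * w) ^ 2 * a k + α ^ 2 * G * (Fintype.card S * a k + b ^ 2) ≤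
          (1 - α * w / 2) * a k + α ^ 2 * G * b ^ 2 := by linarith
      have h9 := mul_le_mul_of_nonneg_left h8 (sq_nonneg lam)
      linarith
  exact hnorm (t + k) (a k) (main k)

end StochasticApproximation

/-! ### Choice of the step size and sample count. -/

section Parameters

/-- A step size that is small relative to the mixing time at the precision given by the step size
itself. -/
theorem exists_stepsize {θ L : ℝ} {n : ℕ} (hθ : 0 < θ) (hθ1 : θ < 1) (hL : 0 ≤ L) (hn : 1 ≤ n) :
    ∃ α : ℝ, 0 < α ∧ α < 1 ∧
      1 / α = 2 * n * (1 + L) * (2 + Real.log (1 / θ) + Real.log n + Real.log (1 + L)) / θ ∧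
      ∀ τ : ℝ, τ ≤ L * (Real.log (1 / α) + 1) → α * (n + τ) ≤ θ := by
  have hn' : (1 : ℝ) ≤ n := by exact_mod_cast hn
  have l1 : 0 ≤ Real.log (1 / θ) := Real.log_nonneg (by rw [le_div_iff₀ hθ]; linarith)
  have l2 : 0 ≤ Real.log n := Real.log_nonneg hn'
  have l3 : 0 ≤ Real.log (1 + L) := Real.log_nonneg (by linarith)
  -- Self-consistent choice: with 1/α = 2n(1 + L)m/θ one gets log(1/α) = m − 2 + log(2m) ≤ 2m − 2,
  -- so the mixing time at precision α is at most 2mL.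
  set m := 2 + Real.log (1 / θ) + Real.log n + Real.log (1 + L) with hm
  have hm2 : 2 ≤ m := by linarith
  set D := 2 * n * (1 + L) * m with hD
  have hnL : 1 ≤ n * (1 + L) := by nlinarith
  have hD1 : 1 ≤ D := by nlinarith
  have hα : 0 < θ / D := by positivity
  refine ⟨θ / D, hα, ?_, ?_, fun τ hτ => ?_⟩
  · rw [div_lt_one (by positivity)]
    linarith
  · rw [one_div_div]
  · have e : Real.log (1 / (θ / D)) = m - 2 + Real.log (2 * m) := by
      rw [show 1 / (θ / D) = 1 / θ * n * (1 + L) * (2 * m) by rw [hD]; field_simp,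
        Real.log_mul (by positivity) (by positivity), Real.log_mul (by positivity) (by positivity),
        Real.log_mul (by positivity) (by positivity), hm]
      ring
    have e2 : Real.log (2 * m) ≤ m := by
      rw [Real.log_mul (by norm_num) (by positivity)]
      have := Real.log_le_sub_one_of_pos (by linarith : 0 < m)
      have := Real.log_two_lt_d9
      linarith
    have h1 : n + τ ≤ D := by
      have h2 : τ ≤ L * (2 * m) := by
        refine hτ.trans (mul_le_mul_of_nonneg_left ?_ hL)
        rw [e]
        linarith
      have h3 : L * (2 * m) ≤ n * (L * (2 * m)) := le_mul_of_one_le_left (by positivity) hn'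
      have h4 : (n : ℝ) * 1 ≤ n * (2 * m) := by gcongr; linarith
      rw [hD]
      linarith
    calc θ / D * (n + τ) ≤ θ / D * D := by gcongr
      _ = θ := by field_simp

/-- Every logarithm is bounded by a multiple of log(1/ε) · lam, using log(1/ε) ≥ 0.69 and lam ≥ 1.
Such a factor occurs once in 1/α and once in the number of contraction steps, hence the squares. The
constants multiply to 30 · 2 · 24 · 6048 = 8709120 ≤ 10^7. -/
theorem sampleSize_le {ε K b L ρ η v w α lam J : ℝ} {n : ℕ} (hε : 0 < ε) (hε2 : ε ≤ 1 / 2)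
    (hK : 0 < K) (hK1 : K ≤ 1) (hb : 1 ≤ b) (hn : 1 ≤ n) (hL : 0 ≤ L) (hρ : 1 ≤ ρ) (hη : 1 ≤ η)
    (hv : 0 ≤ v) (hw : 0 < w) (hw1 : w ≤ 1) (hwb : 1 / w ≤ b / K) (hα : 0 < α) (hα1 : α < 1)
    (hlam : lam = 1 + Real.log b + Real.log n + Real.log ρ + Real.log η + Real.log (1 / K) +
      Real.log (1 + L) + Real.log (1 + v))
    (hαeq : 1 / α = 2 * n * (1 + L) *
      (2 + Real.log (1 / (ε ^ 2 * w ^ 2 / (6048 * ρ ^ 2 * η ^ 2 * b ^ 2))) + Real.log n +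
        Real.log (1 + L)) / (ε ^ 2 * w ^ 2 / (6048 * ρ ^ 2 * η ^ 2 * b ^ 2)))
    (hJ : J ≤ 2 / (α * w) * Real.log (8 * (v + 2 * b) ^ 2 / (K * ε ^ 2)) + 1) :
    2 / α + J ≤ 10 ^ 7 * (1 + L) * (Real.log (1 / ε) ^ 2 / ε ^ 2) * b ^ 2 *
      (n * ρ ^ 2 * η ^ 2) * (1 / w ^ 3) * lam ^ 2 := by
  have hn' : (1 : ℝ) ≤ n := by exact_mod_cast hn
  have l1 : 0 ≤ Real.log b := Real.log_nonneg hb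
  have l2 : 0 ≤ Real.log n := Real.log_nonneg hn'
  have l3 : 0 ≤ Real.log ρ := Real.log_nonneg hρ
  have l4 : 0 ≤ Real.log η := Real.log_nonneg hη
  have l5 : 0 ≤ Real.log (1 / K) := Real.log_nonneg (by rw [le_div_iff₀ hK]; linarith)
  have l6 : 0 ≤ Real.log (1 + L) := Real.log_nonneg (by linarith)
  have l7 : 0 ≤ Real.log (1 + v) := Real.log_nonneg (by linarith)
  have ln2 := Real.log_two_lt_d9
  have ln2' := Real.log_two_gt_d9
  set le := Real.log (1 / ε) with hle
  have l8 : 0.69 ≤ le := by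
    have : Real.log 2 ≤ le := Real.log_le_log (by norm_num) (by
      rw [le_div_iff₀ hε]; linarith)
    linarith
  have hlam1 : 1 ≤ lam := by linarith
  have q1 : le ≤ le * lam := le_mul_of_one_le_right (by linarith) hlam1
  have q2 : 0.69 * lam ≤ le * lam := mul_le_mul_of_nonneg_right l8 (by linarith)
  have hlw : Real.log (1 / w) ≤ Real.log b + Real.log (1 / K) := by
    rw [← Real.log_mul (by positivity) (by positivity), mul_one_div]
    exact Real.log_le_log (by positivity) hwb
  set m := 2 + Real.log (1 / (ε ^ 2 * w ^ 2 / (6048 * ρ ^ 2 * η ^ 2 * b ^ 2))) + Real.log n +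
        Real.log (1 + L) with hm
  have hθ : Real.log (1 / (ε ^ 2 * w ^ 2 / (6048 * ρ ^ 2 * η ^ 2 * b ^ 2))) =
      Real.log 6048 + 2 * Real.log ρ + 2 * Real.log η + 2 * Real.log b + 2 * le +
        2 * Real.log (1 / w) := by
    rw [show 1 / (ε ^ 2 * w ^ 2 / (6048 * ρ ^ 2 * η ^ 2 * b ^ 2)) =
      6048 * ρ ^ 2 * η ^ 2 * b ^ 2 * (1 / ε) ^ 2 * (1 / w) ^ 2 by field_simp,
      Real.log_mul (by positivity) (by positivity), Real.log_mul (by positivity) (by positivity),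
      Real.log_mul (by positivity) (by positivity), Real.log_mul (by positivity) (by positivity),
      Real.log_mul (by positivity) (by positivity)]
    simp only [Real.log_pow, hle]
    push_cast
    ring
  have h6048 : Real.log 6048 ≤ 9.1 := by
    have : Real.log 6048 ≤ Real.log (2 ^ 13) := Real.log_le_log (by norm_num) (by norm_num)
    rw [Real.log_pow] at this
    push_cast at this
    linarith
  have hm24 : m ≤ 24 * (le * lam) := by
    rw [hm, hθ]
    linarith
  have hZ : Real.log (8 * (v + 2 * b) ^ 2 / (K * ε ^ 2)) ≤ 12 * (le * lam) := by
    have h1 : Real.log (v + 2 * b) ≤ Real.log 2 + Real.log b + Real.log (1 + v) := by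
      rw [← Real.log_mul (by norm_num) (by positivity), ← Real.log_mul (by positivity)
        (by positivity)]
      exact Real.log_le_log (by positivity) (by nlinarith)
    have h2 : Real.log (8 * (v + 2 * b) ^ 2 / (K * ε ^ 2)) =
        3 * Real.log 2 + 2 * Real.log (v + 2 * b) + Real.log (1 / K) + 2 * le := by
      rw [show 8 * (v + 2 * b) ^ 2 / (K * ε ^ 2) = 2 ^ 3 * (v + 2 * b) ^ 2 * (1 / K) * (1 / ε) ^ 2 by
        field_simp; norm_num,
        Real.log_mul (by positivity) (by positivity), Real.log_mul (by positivity) (by positivity),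
        Real.log_mul (by positivity) (by positivity)]
      simp only [Real.log_pow, hle]
      push_cast
      ring
    rw [h2]
    linarith
  have hq : 0 ≤ le * lam := by linarith
  have hαw : 1 / α ≤ 1 / (α * w) := by
    refine one_div_le_one_div_of_le (by positivity) ?_
    exact mul_le_of_le_one_right hα.le hw1
  have hone : 1 ≤ 1 / α := by rw [le_div_iff₀ hα]; linarith
  have t1 : 2 / α + J ≤ 30 * (le * lam) * (1 / (α * w)) := by
    have h1 : 2 / (α * w) * Real.log (8 * (v + 2 * b) ^ 2 / (K * ε ^ 2)) ≤
        2 / (α * w) * (12 * (le * lam)) := mul_le_mul_of_nonneg_left hZ (by positivity)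
    have h2 : 2 / α = 2 * (1 / α) := by ring
    have h3 : 2 / (α * w) = 2 * (1 / (α * w)) := by ring
    have h4 : 0.69 * (1 / (α * w)) ≤ le * lam * (1 / (α * w)) :=
      mul_le_mul_of_nonneg_right (by linarith) (by positivity)
    rw [h2]
    rw [h3] at h1 hJ
    linarith
  refine t1.trans ?_
  have t2 : 1 / (α * w) = 1 / α * (1 / w) := by field_simp
  rw [t2, hαeq]
  calc 30 * (le * lam) * (2 * n * (1 + L) * m /
        (ε ^ 2 * w ^ 2 / (6048 * ρ ^ 2 * η ^ 2 * b ^ 2)) * (1 / w))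
      ≤ 30 * (le * lam) * (2 * n * (1 + L) * (24 * (le * lam)) /
        (ε ^ 2 * w ^ 2 / (6048 * ρ ^ 2 * η ^ 2 * b ^ 2)) * (1 / w)) := by gcongr
    _ = 8709120 * ((1 + L) * (le ^ 2 / ε ^ 2) * b ^ 2 * (n * ρ ^ 2 * η ^ 2) * (1 / w ^ 3) *
          lam ^ 2) := by
        field_simp
        norm_num
    _ ≤ 10 ^ 7 * ((1 + L) * (le ^ 2 / ε ^ 2) * b ^ 2 * (n * ρ ^ 2 * η ^ 2) * (1 / w ^ 3) *
          lam ^ 2) := by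
        gcongr
        norm_num
    _ = _ := by ring

theorem pow_mul_le_of_log_le {β Z : ℝ} {k : ℕ} (hβ1 : β ≤ 1) (hZ : 0 < Z)
    (hk : Real.log Z ≤ β * k) : (1 - β) ^ k * Z ≤ 1 := by
  have h1 : (1 - β) ^ k ≤ Real.exp (-(β * k)) := by
    have := pow_le_pow_left₀ (by linarith : 0 ≤ 1 - β) (Real.one_sub_le_exp_neg β) k
    rwa [← Real.exp_nat_mul, mul_neg, mul_comm (k : ℝ)] at this
  calc (1 - β) ^ k * Z ≤ Real.exp (-(β * k)) * Real.exp (β * k) := by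
        refine mul_le_mul h1 ?_ hZ.le (Real.exp_pos _).le
        rw [← Real.exp_log hZ]
        exact Real.exp_le_exp.2 hk
    _ = 1 := by rw [← Real.exp_add]; simp

/-- Puts w in closed form: its cube supplies three factors 1 − γ, and b² the other two. -/
theorem bound_eq {C E H K γ c u lam : ℝ} (hK : 0 < K) (hγ : 0 < 1 - γ) (hc : c < 1) (hu : u < 1) :
    C * E * (1 / (1 - γ)) ^ 2 * H * (1 / (K * (1 - γ) * ((1 - u) / (1 - c))) ^ 3) * lam =
      C * E * (1 / (1 - γ) ^ 5) * (H * (1 - c) ^ 3 / (1 - u) ^ 3) * (1 / K ^ 3) * lam := by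
  have h1 : 1 - c ≠ 0 := by linarith
  have h2 : 1 - u ≠ 0 := by linarith
  field_simp

/-- A step size of order `ε ^ 2 * w ^ 2 / t` satisfies the requirements of the mean square bound
and makes that bound at most `ε ^ 2`. -/
theorem stepsize_bounds {ε ρ η b α w K t card : ℝ} (hε : 0 < ε) (hε2 : ε ≤ 1 / 2) (hρ : 1 ≤ ρ)
    (hη : 1 ≤ η) (hb : 1 ≤ b) (hα : 0 < α) (hw : 0 < w) (hwK : w ≤ K) (hK1 : K ≤ 1) (ht : 0 ≤ t)
    (hcard0 : 0 ≤ card) (hcard : card * K ≤ 1)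
    (hαt : α * t ≤ ε ^ 2 * w ^ 2 / (6048 * ρ ^ 2 * η ^ 2 * b ^ 2)) :
    α * (3 * ρ * η) * t ≤ 1 / 4 ∧ α * (168 * (3 * ρ * η) ^ 2 * t) * card ≤ w / 2 ∧
      ∀ (v : ℝ) (k : ℕ), α ≤ 1 → 0 ≤ v →
        2 / (α * w) * Real.log (8 * (v + 2 * b) ^ 2 / (K * ε ^ 2)) ≤ k →
        card * ((1 - α * w / 2) ^ k * (2 * (v + b + b)) ^ 2 +
          2 * α * (168 * (3 * ρ * η) ^ 2 * t) * b ^ 2 / w) ≤ ε ^ 2 := by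
  have hw1 : w ≤ 1 := hwK.trans hK1
  -- This is where the number of states disappears from the bound.
  have hcardw : card * w ≤ 1 := (mul_le_mul_of_nonneg_left hwK hcard0).trans hcard
  have hε1 : ε ^ 2 ≤ 1 := pow_le_one₀ hε.le (by linarith)
  have hw21 : w ^ 2 ≤ 1 := pow_le_one₀ hw.le hw1
  have hεw : ε ^ 2 * w ^ 2 ≤ 1 := mul_le_one₀ hε1 (sq_nonneg _) hw21
  have hρη : 1 ≤ ρ * η := one_le_mul_of_one_le_of_one_le hρ hη
  have hb2 : 1 ≤ b ^ 2 := one_le_pow₀ hb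
  have h1 : α * t * (ρ * η) ^ 2 * b ^ 2 ≤ ε ^ 2 * w ^ 2 / 6048 := by
    rw [le_div_iff₀ (by positivity)] at hαt ⊢
    linarith
  have h2 : α * t * (ρ * η) ^ 2 ≤ ε ^ 2 * w ^ 2 / 6048 :=
    (le_mul_of_one_le_right (by positivity) hb2).trans h1
  have h3 : α * t * (ρ * η) * 1 ≤ α * t * (ρ * η) * (ρ * η) :=
    mul_le_mul_of_nonneg_left hρη (by positivity)
  -- 6048 = 4 · 168 · 3², the 3 coming from g = 3ρη.
  have h4 : α * (168 * (3 * ρ * η) ^ 2 * t) ≤ ε ^ 2 * w ^ 2 / 4 := by linarith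
  have h5 : α * (168 * (3 * ρ * η) ^ 2 * t) * b ^ 2 ≤ ε ^ 2 * w ^ 2 / 4 := by linarith
  refine ⟨by linarith, ?_, fun v k hα1 hv hk => ?_⟩
  · calc _ ≤ ε ^ 2 * w ^ 2 / 4 * card := mul_le_mul_of_nonneg_right h4 hcard0
      _ = ε ^ 2 / 4 * w * (card * w) := by ring
      _ ≤ ε ^ 2 / 4 * w * 1 := mul_le_mul_of_nonneg_left hcardw (by positivity)
      _ ≤ w / 2 := by nlinarith
  -- `Z` is chosen so that the transient term is K ε²/2 times (1 − αw/2)^k Z; the noise term takes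
  -- the other ε²/2.
  · set Z := 8 * (v + 2 * b) ^ 2 / (K * ε ^ 2) with hZ
    have hK0 : 0 < K := hw.trans_le hwK
    have hZ0 : 0 < Z := by positivity
    have hlog : Real.log Z ≤ α * w / 2 * k := by
      have e : Real.log Z = α * w / 2 * (2 / (α * w) * Real.log Z) := by field_simp
      rw [e]
      exact mul_le_mul_of_nonneg_left hk (by positivity)
    have hαw : α * w ≤ 1 := mul_le_one₀ hα1 hw.le hw1
    have hpow := pow_mul_le_of_log_le (by linarith : α * w / 2 ≤ 1) hZ0 hlog
    set P := (1 - α * w / 2) ^ k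
    have e1 : P * (2 * (v + b + b)) ^ 2 = P * Z * (K * ε ^ 2 / 2) := by
      rw [hZ]
      field_simp
      ring
    have b1 : card * (P * (2 * (v + b + b)) ^ 2) ≤ ε ^ 2 / 2 := by
      rw [e1]
      calc card * (P * Z * (K * ε ^ 2 / 2))
          ≤ card * (1 * (K * ε ^ 2 / 2)) := by gcongr
        _ = card * K * (ε ^ 2 / 2) := by ring
        _ ≤ 1 * (ε ^ 2 / 2) := mul_le_mul_of_nonneg_right hcard (by positivity)
        _ = _ := one_mul _
    have b2 : card * (2 * α * (168 * (3 * ρ * η) ^ 2 * t) * b ^ 2 / w) ≤ ε ^ 2 / 2 := by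
      calc _ = card * (2 * (α * (168 * (3 * ρ * η) ^ 2 * t) * b ^ 2) / w) := by ring
        _ ≤ card * (2 * (ε ^ 2 * w ^ 2 / 4) / w) := by gcongr
        _ = card * w * (ε ^ 2 / 2) := by field_simp; norm_num
        _ ≤ 1 * (ε ^ 2 / 2) := mul_le_mul_of_nonneg_right hcardw (by positivity)
        _ = _ := one_mul _
    rw [mul_add]
    linarith

/-- Integrate f ≤ (f² + ε²) / (2ε). -/
theorem integral_le_of_integral_sq_le {Ω : Type*} [MeasurableSpace Ω] {μ : Measure Ω}
    [IsProbabilityMeasure μ] {f : Ω → ℝ} {ε : ℝ} (hε : 0 < ε) (hf : Integrable f μ)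
    (hf2 : Integrable (fun ω => f ω ^ 2) μ) (h : ∫ ω, f ω ^ 2 ∂μ ≤ ε ^ 2) : ∫ ω, f ω ∂μ ≤ ε := by
  have h1 : ∫ ω, f ω ∂μ ≤ ∫ ω, (2 * ε)⁻¹ * (f ω ^ 2 + ε ^ 2) ∂μ := by
    refine integral_mono hf ((hf2.add (integrable_const _)).const_mul _) fun ω => ?_
    simp only
    rw [inv_mul_eq_div, le_div_iff₀ (by positivity)]
    nlinarith [sq_nonneg (f ω - ε)]
  refine h1.trans ?_
  rw [integral_const_mul, integral_add hf2 (integrable_const _)]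
  simp only [integral_const, probReal_univ, one_smul]
  rw [inv_mul_le_iff₀ (by positivity)]
  linarith

end Parameters

/-! ### Application to V-trace. -/

section VTraceBound

variable {S A : Type*} [Fintype S] [DecidableEq S] [Nonempty S] [Fintype A]
  {M : MDP S A} {πb π : Policy S A} {n : ℕ} {cbar ρbar : ℝ}

/-- Coordinate s is a convex combination, with weight ακ(s), of v(s) and a contracted value; the
least visited state determines the rate. -/
theorem MDP.norm_add_smul_drift_le (hπb : ∀ s a, 0 < πb.prob s a) (hc : 0 ≤ cbar) {κ : S → ℝ}
    {K α : ℝ} (hK : ∀ s, K ≤ κ s) (hκ0 : ∀ s, 0 ≤ κ s) (hκ1 : ∀ s, κ s ≤ 1) (hα : 0 ≤ α)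
    (hα1 : α ≤ 1) {w : ℝ} (hw : w = K * (1 - M.γ) *
      ∑ i ∈ Finset.range n, (M.γ * Cmin πb π cbar) ^ i) (hw1 : w ≤ 1) (v : S → ℝ) :
    ‖v + α • M.drift πb π n cbar κ v‖ ≤ (1 - α * w) * ‖v‖ := by
  have hαw : α * w ≤ 1 := by nlinarith
  rw [pi_norm_le_iff_of_nonneg (mul_nonneg (by linarith) (norm_nonneg v))]
  intro s
  set q := (1 - M.γ) * ∑ i ∈ Finset.range n, (M.γ * Cmin πb π cbar) ^ i with hq
  have hq0 : 0 ≤ q := mul_nonneg (sub_nonneg.2 M.γ_lt_one.le) (Finset.sum_nonneg fun i _ =>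
    pow_nonneg (mul_nonneg M.γ_pos.le (Cmin_nonneg π hc)) i)
  have e : (v + α • M.drift πb π n cbar κ v) s =
      (1 - α * κ s) * v s + α * κ s * (v s + M.meanUpdate πb π cbar n v s) := by
    rw [Pi.add_apply, Pi.smul_apply, M.drift_apply, smul_eq_mul]
    ring
  have h1 : 0 ≤ 1 - α * κ s := by nlinarith [hκ0 s, hκ1 s]
  have h2 : 0 ≤ α * κ s := mul_nonneg hα (hκ0 s)
  rw [e, Real.norm_eq_abs]
  calc _ ≤ (1 - α * κ s) * |v s| + α * κ s * |v s + M.meanUpdate πb π cbar n v s| := by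
        refine (abs_add_le _ _).trans (le_of_eq ?_)
        rw [abs_mul, abs_mul, abs_of_nonneg h1, abs_of_nonneg h2]
    _ ≤ (1 - α * κ s) * ‖v‖ + α * κ s * ((1 - q) * ‖v‖) := by
        gcongr
        · exact abs_apply_le_norm v s
        · exact M.abs_add_meanUpdate_le π hπb hc n v s
    _ = (1 - α * (κ s * q)) * ‖v‖ := by ring
    _ ≤ (1 - α * w) * ‖v‖ := by
        rw [hw, mul_assoc K]
        gcongr
        exact hK s

/-- Mean square error of the V-trace iterates with constant step size. -/
theorem integral_sq_norm_iterate_sub_le {Ω : Type*} [MeasurableSpace Ω] {μ : Measure Ω}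
    [IsProbabilityMeasure μ] {X : ℕ → Ω → S} {Y : ℕ → Ω → A} (h : IsTrajectory μ M πb X Y)
    (hπb : ∀ s a, 0 < πb.prob s a) (hn : 1 ≤ n) (hc : 1 ≤ cbar) (hρ1 : 1 ≤ ρbar)
    (hρ : ∀ s a, π.prob s a / πb.prob s a ≤ ρbar) {κ : S → ℝ} {K : ℝ} (hK0 : 0 < K)
    (hK : ∀ s, K ≤ κ s) (hκ1 : ∀ s, κ s ≤ 1) {α w : ℝ} (hα : 0 < α) (hα1 : α ≤ 1)
    (hw : w = K * (1 - M.γ) * ∑ i ∈ Finset.range n, (M.γ * Cmin πb π cbar) ^ i)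
    (hw0 : 0 < w) (hw1 : w ≤ 1) {τ : ℕ}
    (hτ : ∀ s s', |(M.trans πb ^ τ) s s' - κ s'| ≤ 2 * α)
    (hαgt : α * (3 * ρbar * eta n M.γ cbar) * (n + τ : ℕ) ≤ 1 / 4)
    (hstep : α * (168 * (3 * ρbar * eta n M.γ cbar) ^ 2 * (n + τ : ℕ)) * Fintype.card S ≤ w / 2)
    (V₀ : S → ℝ) (k : ℕ) :
    ∫ ω, ‖iterate M πb π n cbar ρbar (fun _ => α) V₀ (fun i => X i ω) (fun i => Y i ω)
        (n + τ + k) - M.value π‖ ^ 2 ∂μ ≤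
      Fintype.card S * ((1 - α * w / 2) ^ k * (2 * (‖V₀‖ + 1 / (1 - M.γ) + 1 / (1 - M.γ))) ^ 2 +
        2 * α * (168 * (3 * ρbar * eta n M.γ cbar) ^ 2 * (n + τ : ℕ)) *
          (1 / (1 - M.γ)) ^ 2 / w) := by
  have hc0 : 0 ≤ cbar := by linarith
  have hρ0 : 0 ≤ ρbar := by linarith
  have hγ : 0 < 1 - M.γ := sub_pos.2 M.γ_lt_one
  have hη : 1 ≤ eta n M.γ cbar := one_le_eta hn (mul_nonneg M.γ_pos.le hc0)
  have hρη : 1 ≤ ρbar * eta n M.γ cbar := by nlinarith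
  have hb : 1 ≤ 1 / (1 - M.γ) := by
    rw [le_div_iff₀ hγ]
    linarith [M.γ_pos]
  have hval := M.norm_value_le π
  have hκ0 : ∀ s, 0 ≤ κ s := fun s => hK0.le.trans (hK s)
  set V : ℕ → Ω → S → ℝ := fun j ω =>
    iterate M πb π n cbar ρbar (fun _ => α) V₀ (fun i => X i ω) (fun i => Y i ω) j with hV
  have hVdep : ∀ j m, j + n ≤ m + 1 → DependsUpTo X Y m (V j) := fun j m hm =>
    dependsUpTo_iterate n α V₀ hm
  set x : ℕ → Ω → S → ℝ := fun j ω => V j ω - M.value π with hx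
  set U : ℕ → Ω → (S → ℝ) → (S → ℝ) := fun j ω v => Pi.single (X j ω)
    (M.correction πb π cbar ρbar (v + M.value π) (fun i => X i ω) (fun i => Y i ω) n j) with hU
  have hUV : ∀ j i ω, U j ω (x i ω) = Pi.single (X j ω)
      (M.correction πb π cbar ρbar (V i ω) (fun i => X i ω) (fun i => Y i ω) n j) := by
    intro j i ω
    simp only [hU, hx, sub_add_cancel]
  -- Here g = 3 ρbar η and b = 1/(1 − γ): since ‖V_π‖ ≤ b and b ≥ 1, 1 + 2‖v + V_π‖ ≤ 3(‖v‖ + b).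
  refine integral_sq_norm_le (x := x) (U := U) (Abar := M.drift πb π n cbar κ)
    (R := ‖V₀‖ + 1 / (1 - M.γ)) hα (by linarith) (by positivity) (by omega)
    hw0 (by nlinarith) hαgt hstep ?_ ?_ ?_ ?_ ?_ ?_ ?_ ?_ ?_ k
  · intro v
    rw [pi_norm_le_iff_of_nonneg (by positivity)]
    intro s
    rw [M.drift_apply, Real.norm_eq_abs, abs_mul, abs_of_nonneg (hκ0 s)]
    exact (mul_le_of_le_one_left (abs_nonneg _) (hκ1 s)).trans
      ((abs_apply_le_norm _ s).trans (M.norm_meanUpdate_le π hπb hc0 n v))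
  · exact M.norm_add_smul_drift_le hπb hc0 hK hκ0 hκ1 hα.le hα1 hw hw1
  · intro j ω
    rw [hUV]
    simp only [hx, hV, iterate_succ_eq]
    abel
  · intro ω
    exact (norm_sub_le _ _).trans (add_le_add le_rfl hval)
  · intro j ω v
    simp only [hU, Pi.norm_single, Real.norm_eq_abs]
    refine (M.abs_correction_le π hπb hc0 hρ0 _ _ _ n j).trans ?_
    have h1 := norm_add_le v (M.value π)
    calc ρbar * eta n M.γ cbar * (1 + 2 * ‖v + M.value π‖)
        ≤ ρbar * eta n M.γ cbar * (3 * (‖v‖ + 1 / (1 - M.γ))) := by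
          gcongr
          linarith [norm_nonneg v]
      _ = _ := by ring
  · intro j ω v v'
    simp only [hU]
    rw [← Pi.single_sub, Pi.norm_single, Real.norm_eq_abs]
    refine (M.abs_correction_sub_le π hπb hc0 hρ0 _ _ _ _ n j).trans ?_
    rw [add_sub_add_right_eq_sub]
    nlinarith [norm_nonneg (v - v')]
  · intro j φ
    exact DependsUpTo.integrable h ((hVdep j (j + n) (by omega)).comp fun V => φ (V - M.value π))
  · intro i φ
    simp only [hUV]
    have h1 : DependsUpTo X Y (i + (n + τ) + n) (V i) := hVdep i _ (by omega)
    exact DependsUpTo.integrable h (h1.map₂ ((dependsUpTo_state X Y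
      (by omega : i + (n + τ) ≤ i + (n + τ) + n)).map₂ (dependsUpTo_correction (M := M) (πb := πb)
        (π := π) (cbar := cbar) (ρbar := ρbar) n h1 le_rfl) fun s c => Pi.single s c)
          fun V u => φ (V - M.value π) u)
  · intro i ℓ lam hlam hℓ
    simp only [hUV]
    -- V_i is known at time i + n − 1, so the delay n + τ leaves one step with a known action
    -- followed by τ steps of the chain.
    obtain ⟨n', rfl⟩ : ∃ n', n = n' + 1 := ⟨n - 1, by omega⟩
    rw [show i + (n' + 1 + τ) = i + n' + 1 + τ by omega]
    have h1 : DependsUpTo X Y (i + n') (V i) := hVdep i _ (by omega)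
    exact h.abs_integral_mul_update_sub_le hπb hc0 hρ hτ (n' + 1) (h1.comp fun V =>
      ℓ (V - M.value π + α • M.drift πb π (n' + 1) cbar κ (V - M.value π))) h1 ℓ hℓ hlam

/-- For a small step size, the V-trace iterates are accurate after the burn-in. -/
theorem integral_norm_iterate_sub_le {Ω : Type*} [MeasurableSpace Ω] {μ : Measure Ω}
    [IsProbabilityMeasure μ] {X : ℕ → Ω → S} {Y : ℕ → Ω → A} (h : IsTrajectory μ M πb X Y)
    (hπb : ∀ s a, 0 < πb.prob s a) (hn : 1 ≤ n) (hc : 1 ≤ cbar) (hρ1 : 1 ≤ ρbar)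
    (hρ : ∀ s a, π.prob s a / πb.prob s a ≤ ρbar) {κ : S → ℝ} {K : ℝ} (hK0 : 0 < K)
    (hK : ∀ s, K ≤ κ s) (hκ1 : ∀ s, κ s ≤ 1) {α w : ℝ} (hα0 : 0 < α) (hα1 : α ≤ 1)
    (hw : w = K * (1 - M.γ) * ∑ i ∈ Finset.range n, (M.γ * Cmin πb π cbar) ^ i)
    (hw0 : 0 < w) (hwK : w ≤ K) (hK1 : K ≤ 1) (hcard : Fintype.card S * K ≤ 1) {τ : ℕ}
    (hτ : ∀ s s', |(M.trans πb ^ τ) s s' - κ s'| ≤ 2 * α) {ε : ℝ} (hε : 0 < ε) (hε2 : ε ≤ 1 / 2)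
    (hαt : α * (n + τ) ≤
      ε ^ 2 * w ^ 2 / (6048 * ρbar ^ 2 * eta n M.γ cbar ^ 2 * (1 / (1 - M.γ)) ^ 2))
    {V₀ : S → ℝ} {k : ℕ} (hk : 2 / (α * w) *
      Real.log (8 * (‖V₀‖ + 2 * (1 / (1 - M.γ))) ^ 2 / (K * ε ^ 2)) ≤ k) :
    ∫ ω, ‖iterate M πb π n cbar ρbar (fun _ => α) V₀ (fun i => X i ω) (fun i => Y i ω)
        (n + τ + k) - M.value π‖ ∂μ ≤ ε := by
  have hγ : 0 < 1 - M.γ := sub_pos.2 M.γ_lt_one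
  have hη : 1 ≤ eta n M.γ cbar := one_le_eta hn (mul_nonneg M.γ_pos.le (by linarith))
  have hb : 1 ≤ 1 / (1 - M.γ) := by
    rw [le_div_iff₀ hγ]
    linarith [M.γ_pos]
  have hαt' : α * (n + τ : ℕ) ≤
      ε ^ 2 * w ^ 2 / (6048 * ρbar ^ 2 * eta n M.γ cbar ^ 2 * (1 / (1 - M.γ)) ^ 2) := by
    exact_mod_cast hαt
  obtain ⟨h1, h2, h3⟩ := stepsize_bounds hε hε2 hρ1 hη hb hα0 hw0 hwK hK1 (Nat.cast_nonneg _)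
    (Nat.cast_nonneg _) hcard hαt'
  have hdep := dependsUpTo_iterate (M := M) (πb := πb) (π := π) (cbar := cbar)
    (ρbar := ρbar) (X := X) (Y := Y) n α V₀ (k := n + τ + k) (m := n + τ + k + n) (by omega)
  refine integral_le_of_integral_sq_le hε (DependsUpTo.integrable h (hdep.comp fun V =>
    ‖V - M.value π‖)) (DependsUpTo.integrable h (hdep.comp fun V => ‖V - M.value π‖ ^ 2)) ?_
  refine (integral_sq_norm_iterate_sub_le h hπb hn hc hρ1 hρ hK0 hK hκ1 hα0 hα1 hw hw0
    (hwK.trans hK1) hτ h1 h2 V₀ k).trans ?_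
  exact h3 _ _ hα1 (norm_nonneg V₀) hk

end VTraceBound

end VTrace

/-! ### The sample complexity bound. -/

theorem corollary3p2 :
    -- a numerical constant `C` and a numerical exponent `p` of the logarithmic factors
    ∃ (C : ℝ) (p : ℕ), 0 < C ∧
    ∀ (S A : Type*) [Fintype S] [DecidableEq S] [Nonempty S] [Fintype A]
      (M : VTrace.MDP S A) (πb π : VTrace.Policy S A) (n : ℕ) (cbar ρbar : ℝ),
      1 ≤ n →
      -- `ρbar = 1 / min π_b`, which presupposes that the minimum is positive
      (∀ s a, 0 < πb.prob s a) →
      ρbar = 1 / ⨅ q : S × A, πb.prob q.1 q.2 →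
      1 ≤ cbar → cbar ≤ ρbar →
      (M.trans πb).IsIrreducible →
      VTrace.IsAperiodic (M.trans πb) →
      -- the stationary distribution `κ` of the state chain exists and is unique
      ∃ κ : S → ℝ, (∀ κ', VTrace.IsStationaryDist (M.trans πb) κ' ↔ κ' = κ) ∧
      -- the state chain mixes geometrically
      (∃ L : ℝ, VTrace.IsMixingConst (M.trans πb) κ L) ∧
      ∀ L : ℝ, VTrace.IsMixingConst (M.trans πb) κ L →
      ∀ (V₀ : S → ℝ) (ε : ℝ), 0 < ε → ε ≤ 1 / 2 →
      -- a constant step size `α` and a number `N` of iterations; `V_N` uses `N + n` samples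
      ∃ (α : ℝ) (N : ℕ), 0 < α ∧ α < 1 ∧
        (N + n : ℝ) ≤
          C * (1 + L)
            * (Real.log (1 / ε) ^ 2 / ε ^ 2)
            * (1 / (1 - M.γ) ^ 5)
            * (n * ρbar ^ 2 * VTrace.eta n M.γ cbar ^ 2
                * (1 - M.γ * VTrace.Cmin πb π cbar) ^ 3
                / (1 - (M.γ * VTrace.Cmin πb π cbar) ^ n) ^ 3)
            * (1 / (⨅ s, κ s) ^ 3)
            * (1 + Real.log (1 / (1 - M.γ)) + Real.log n + Real.log ρbar
                + Real.log (VTrace.eta n M.γ cbar) + Real.log (1 / ⨅ s, κ s)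
                + Real.log (1 + L) + Real.log (1 + ‖V₀‖)) ^ p ∧
        ∀ (Ω : Type*) [MeasurableSpace Ω] (μ : MeasureTheory.Measure Ω)
          [MeasureTheory.IsProbabilityMeasure μ] (X : ℕ → Ω → S) (Y : ℕ → Ω → A),
          VTrace.IsTrajectory μ M πb X Y →
          ∀ k : ℕ, N ≤ k →
            ∫ ω, ‖VTrace.iterate M πb π n cbar ρbar (fun _ => α) V₀
                (fun i => X i ω) (fun i => Y i ω) k - M.value π‖ ∂μ ≤ ε := by
  refine ⟨10 ^ 7, 2, by norm_num, ?_⟩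
  intro S A _ _ _ _ M πb π n cbar ρbar hn hπb hρdef hc hcρ hirr hap
  obtain ⟨N₀, hN₀⟩ := VTrace.exists_pow_pos hirr hap
  have hrow := M.trans_row_sum πb
  obtain ⟨κ, hκ, hκpos⟩ := VTrace.exists_unique_stationary hrow hN₀
  have hκst : VTrace.IsStationaryDist (M.trans πb) κ := (hκ κ).2 rfl
  refine ⟨κ, hκ, VTrace.exists_isMixingConst (M.trans_nonneg πb) hrow hN₀ hκst, ?_⟩
  intro L hL V₀ ε hε hε2
  have hc0 : 0 ≤ cbar := by linarith
  have hρ1 : 1 ≤ ρbar := hc.trans hcρ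
  have hρ : ∀ s a, π.prob s a / πb.prob s a ≤ ρbar := by
    intro s a
    have : Nonempty (S × A) := ⟨(s, a)⟩
    obtain ⟨q, hq⟩ := exists_eq_ciInf_of_finite (f := fun q : S × A => πb.prob q.1 q.2)
    have h1 : ⨅ q : S × A, πb.prob q.1 q.2 ≤ πb.prob s a :=
      ciInf_le (Set.finite_range fun q : S × A => πb.prob q.1 q.2).bddBelow (s, a)
    have h2 : 0 < ⨅ q : S × A, πb.prob q.1 q.2 := hq ▸ hπb q.1 q.2
    have h3 : π.prob s a ≤ 1 := by
      rw [← π.sum_eq_one s]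
      exact Finset.single_le_sum (fun a _ => π.nonneg s a) (Finset.mem_univ a)
    rw [hρdef]
    exact div_le_div₀ zero_le_one h3 h2 h1
  set K := ⨅ s, κ s with hKdef
  have hK : ∀ s, K ≤ κ s := fun s => ciInf_le (Set.finite_range κ).bddBelow s
  have hK0 : 0 < K := by
    obtain ⟨s, hs⟩ := exists_eq_ciInf_of_finite (f := κ)
    rw [hKdef, ← hs]
    exact hκpos s
  have hκ1 : ∀ s, κ s ≤ 1 := fun s => by
    rw [← hκst.1.2]
    exact Finset.single_le_sum (fun s _ => (hκpos s).le) (Finset.mem_univ s)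
  have hK1 : K ≤ 1 := (hK (Classical.arbitrary S)).trans (hκ1 _)
  have hcard : Fintype.card S * K ≤ 1 := by
    rw [← hκst.1.2, ← nsmul_eq_mul]
    exact Finset.card_nsmul_le_sum _ _ _ fun s _ => hK s
  -- At δ = 1 the logarithm vanishes, so `L` dominates a natural number.
  have hL0 : 0 ≤ L := by
    have := (Nat.cast_nonneg _).trans (hL 1 one_pos le_rfl)
    simpa using this
  have hγ : 0 < 1 - M.γ := sub_pos.2 M.γ_lt_one
  have hC0 := VTrace.Cmin_nonneg (πb := πb) π hc0
  have hγC0 : 0 ≤ M.γ * VTrace.Cmin πb π cbar := mul_nonneg M.γ_pos.le hC0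
  have hγC : M.γ * VTrace.Cmin πb π cbar < 1 :=
    (mul_le_of_le_one_right M.γ_pos.le (VTrace.Cmin_le_one π)).trans_lt M.γ_lt_one
  set c := M.γ * VTrace.Cmin πb π cbar with hcdef
  set d := ∑ i ∈ Finset.range n, c ^ i with hd
  have hd1 : 1 ≤ d := by
    have := Finset.single_le_sum (f := fun i => c ^ i) (fun i _ => pow_nonneg hγC0 i)
      (Finset.mem_range.2 hn)
    simpa using this
  have hdeq : d = (1 - c ^ n) / (1 - c) := by
    rw [hd, geom_sum_eq hγC.ne, ← neg_div_neg_eq, neg_sub, neg_sub]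
  set η := VTrace.eta n M.γ cbar with hηdef
  have hη : 1 ≤ η := VTrace.one_le_eta hn (mul_nonneg M.γ_pos.le hc0)
  set b := 1 / (1 - M.γ) with hbdef
  have hb : 1 ≤ b := by
    rw [hbdef, le_div_iff₀ hγ]
    linarith [M.γ_pos]
  set w := K * (1 - M.γ) * d with hw
  have hw0 : 0 < w := by positivity
  have hwK : w ≤ K := by
    rw [hw, mul_assoc]
    exact mul_le_of_le_one_right hK0.le (M.sum_geom_Cmin_le π n hc0)
  have hw1 : w ≤ 1 := hwK.trans hK1
  have hwb : 1 / w ≤ b / K := by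
    rw [hw, hbdef, div_div, mul_comm K, mul_assoc]
    refine one_div_le_one_div_of_le (by positivity) ?_
    exact mul_le_mul_of_nonneg_left (le_mul_of_one_le_right hK0.le hd1) hγ.le
  set θ := ε ^ 2 * w ^ 2 / (6048 * ρbar ^ 2 * η ^ 2 * b ^ 2) with hθ
  have hε1 : ε ^ 2 ≤ 1 := by nlinarith
  have hw21 : w ^ 2 ≤ 1 := by nlinarith
  have hθ0 : 0 < θ := by positivity
  have hθ1 : θ < 1 := by
    rw [hθ, div_lt_one (by positivity)]
    have h1 : ε ^ 2 * w ^ 2 ≤ 1 := mul_le_one₀ hε1 (sq_nonneg _) hw21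
    have h2 : 1 ≤ ρbar ^ 2 * η ^ 2 * b ^ 2 :=
      one_le_mul_of_one_le_of_one_le (one_le_mul_of_one_le_of_one_le (one_le_pow₀ hρ1)
        (one_le_pow₀ hη)) (one_le_pow₀ hb)
    linarith
  obtain ⟨α, hα0, hα1, hαeq, hατ⟩ := VTrace.exists_stepsize hθ0 hθ1 hL0 hn
  set τ := VTrace.mixingTime (M.trans πb) κ α
  have hτ : ∀ s s', |(M.trans πb ^ τ) s s' - κ s'| ≤ 2 * α :=
    VTrace.mixingTime_spec (M.trans_nonneg πb) hrow hN₀ hκst hα0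
  have hαt : α * (n + τ) ≤ θ := hατ τ (hL α hα0 hα1.le)
  set Z := 8 * (‖V₀‖ + 2 * b) ^ 2 / (K * ε ^ 2) with hZ
  have hZ0 : 0 < Z := by positivity
  set J := ⌈2 / (α * w) * Real.log Z⌉₊
  -- n + τ steps for the delay window, then J of contraction. With the n look-ahead samples the
  -- total is at most 2(n + τ) + J ≤ 2/α + J, because α(n + τ) ≤ θ < 1.
  refine ⟨α, n + τ + J, hα0, hα1, ?_, ?_⟩
  · have hZ1 : 0 ≤ Real.log Z := by
      refine Real.log_nonneg ?_
      rw [hZ, le_div_iff₀ (by positivity)]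
      have : K * ε ^ 2 ≤ 1 := mul_le_one₀ hK1 (sq_nonneg _) hε1
      have h2 : 1 ≤ (‖V₀‖ + 2 * b) ^ 2 := one_le_pow₀ (by linarith [norm_nonneg V₀])
      linarith
    have hJ : (J : ℝ) ≤ 2 / (α * w) * Real.log Z + 1 :=
      (Nat.ceil_lt_add_one (by positivity)).le
    have hmain := VTrace.sampleSize_le hε hε2 hK0 hK1 hb hn hL0 hρ1 hη (norm_nonneg V₀) hw0 hw1 hwb
      hα0 hα1 rfl hαeq hJ
    have ht : (n + τ : ℝ) ≤ 1 / α := by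
      rw [le_div_iff₀ hα0]
      linarith
    have hτ0 : (0 : ℝ) ≤ τ := Nat.cast_nonneg _
    have h1cn : c ^ n < 1 := pow_lt_one₀ hγC0 hγC (by omega)
    have hsum : ((n + τ + J : ℕ) : ℝ) + n ≤ 2 / α + J := by
      rw [show 2 / α = 2 * (1 / α) by ring]
      push_cast
      linarith
    rw [hw, hdeq, VTrace.bound_eq hK0 hγ hγC h1cn] at hmain
    exact hsum.trans hmain
  · intro Ω _ μ _ X Y h k hk
    obtain ⟨k, rfl⟩ := Nat.exists_eq_add_of_le hk
    rw [add_assoc (n + τ)]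
    refine VTrace.integral_norm_iterate_sub_le h hπb hn hc hρ1 hρ hK0 hK hκ1 hα0 hα1.le hw hw0 hwK
      hK1 hcard hτ hε hε2 hαt ((Nat.le_ceil _).trans ?_)
    exact_mod_cast Nat.le_add_right J k
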